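/- Let $X\subset\mathbb{R}^m$ be convex and compact, and let $\mu,\nu$ be finite positive Borel measures on $X$ with disjoint supports and equal total mass $\|\mu\|=\|\nu\|$. Let $1-\frac1m<\alpha<1$. A rectifiable $1$-current $T=\tau(M,\theta,\xi)$ in $\mathbb{R}^m$ is given by $T(\omega)=\int_M\langle\omega,\xi\rangle\,\theta\,d\mathcal{H}^1$, where $M$ is an $\mathcal{H}^1$-measurable countably $1$-rectifiable set, $\theta>0$ is $\mathcal{H}^1$-integrable on $M$, and $\xi$ is an $\mathcal{H}^1$-measurable unit tangent field on $M$. Put $\mathbf{M}_\alpha(T)=\int_M\theta^\alpha\,d\mathcal{H}^1$ and $\partial T(\varphi)=T(d\varphi)$. For a $0$-current $S$ let $\mathbf{M}(S)=\sup\{|S(\varphi)|:\varphi\in C_c^\infty(\mathbb{R}^m),\ |\varphi|\le1\}$ be its mass; for a finite signed measure this is its total variation. Let $$d_\alpha(\mu,\nu)=\inf\{\mathbf{M}_\alpha(T): T \text{ a rectifiable } 1\text{-current with } \partial T=\nu-\mu\}.$$ For signed measures write $\sigma\preceq\tau$ if $\sigma^+\le\tau^+$ and $\sigma^-\le\tau^-$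 for the Jordan decompositions. For $c\in\mathbb{R}$, a solution of the constant-payoff problem with parameter $c$ is a minimizer of $$\mathbf{E}_\alpha^c(T)=\mathbf{M}_\alpha(T)-c\,\mathbf{M}(\partial T)$$ among all rectifiable $1$-currents $T$ whose boundary is a signed measure with $\partial T\preceq\nu-\mu$. Let $I\subset\mathbb{R}$ be a set of parameters containing $(0,\infty)$ (for example $I=(0,\infty)$ or $I=\mathbb{R}$), and for every $c\in I$ let $T_c^*$ be any solution of the problem with parameter $c$. Then, as functions of $c\in I$ (monotonicity being understood in the non-strict sense): 1. $\mathbf{E}_\alpha^c(T_c^*)$ is decreasing; 2. $\mathbf{M}_\alpha(T_c^*)$ is increasing, $d_\alpha(\mu,\nu)<\infty$, and $\lim_{c\to\infty}\mathbf{M}_\alpha(T_c^*)=d_\alpha(\mu,\nu)$; 3. $\mathbf{M}(\partial T_c^*)$ is increasing, and $\lim_{c\to\infty}\partial T_c^*=\nu-\mu$ in total variation, i.e. $\lim_{c\to\infty}\mathbf{M}\big(\partial T_c^*-(\nu-\mu)\big)=0$. -/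

import Mathlib

open MeasureTheory Filter Topology Set
open scoped ENNReal ContDiff Distributions

noncomputable section

namespace Ramified

/-- The Euclidean space `ℝ^m`. -/
abbrev E (m : ℕ) : Type := EuclideanSpace ℝ (Fin m)

/-! ### Currents of dimension 0 and 1 in `ℝ^m` -/

/-- Smooth compactly supported `0`-forms on `ℝ^m`. -/
abbrev ZeroForm (m : ℕ) : Type := 𝓓((⊤ : TopologicalSpace.Opens (E m)), ℝ)

/-- Smooth compactly supported `1`-forms on `ℝ^m`. -/
abbrev OneForm (m : ℕ) : Type := 𝓓((⊤ : TopologicalSpace.Opens (E m)), E m →L[ℝ] ℝ)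

/-- `0`-dimensional currents: continuous linear functionals on `0`-forms. -/
abbrev ZeroCurrent (m : ℕ) : Type := ZeroForm m →L[ℝ] ℝ

/-- `1`-dimensional currents: continuous linear functionals on `1`-forms. -/
abbrev OneCurrent (m : ℕ) : Type := OneForm m →L[ℝ] ℝ

/-- The exterior derivative of a `0`-form. -/
def extDeriv {m : ℕ} : ZeroForm m →L[ℝ] OneForm m :=
  TestFunction.fderivCLM ℝ (⊤ : ℕ∞) (⊤ : ℕ∞)

theorem extDeriv_apply {m : ℕ} (φ : ZeroForm m) (x : E m) :
    extDeriv φ x = fderiv ℝ φ x := by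
  have h := TestFunction.fderivCLM_apply_of_le (𝕜 := ℝ) (k := (⊤ : ℕ∞)) φ (by simp)
  exact congrFun h x

/-- The boundary of a `1`-current, `∂T(φ) = T(dφ)`. -/
def boundary {m : ℕ} (T : OneCurrent m) : ZeroCurrent m := T.comp extDeriv

/-- The mass of a `0`-current: the supremum of `|S(φ)|` over all `0`-forms with `‖φ‖ ≤ 1`. -/
def mass {m : ℕ} (S : ZeroCurrent m) : ℝ≥0∞ :=
  ⨆ (φ : ZeroForm m) (_ : ∀ x, |φ x| ≤ 1), ENNReal.ofReal |S φ|

/-! ### Measures as `0`-currents -/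

/-- The `0`-current `φ ↦ ∫ φ dμ` of a finite measure. -/
def ofMeasure {m : ℕ} (μ : Measure (E m)) : ZeroCurrent m :=
  TestFunction.integralAgainstBilinCLM (ContinuousLinearMap.mul ℝ ℝ) μ (fun _ => (1 : ℝ))

theorem ofMeasure_apply {m : ℕ} (μ : Measure (E m)) [IsFiniteMeasure μ] (φ : ZeroForm m) :
    ofMeasure μ φ = ∫ x, φ x ∂μ := by
  have h : LocallyIntegrableOn (fun _ : E m => (1 : ℝ))
      ((⊤ : TopologicalSpace.Opens (E m)) : Set (E m)) μ :=
    (integrable_const (1 : ℝ)).locallyIntegrable.locallyIntegrableOn _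
  rw [ofMeasure, TestFunction.integralAgainstBilinCLM_eq_integral h]
  simp

/-- The `0`-current `φ ↦ ∫ φ dσ = ∫ φ dσ⁺ - ∫ φ dσ⁻` of a signed measure. -/
def ofSigned {m : ℕ} (σ : SignedMeasure (E m)) : ZeroCurrent m :=
  ofMeasure σ.toJordanDecomposition.posPart - ofMeasure σ.toJordanDecomposition.negPart

/-- `σ ⪯ τ` for signed measures: `σ⁺ ≤ τ⁺` and `σ⁻ ≤ τ⁻` for the Jordan decompositions. -/
def Preceq {m : ℕ} (σ τ : SignedMeasure (E m)) : Prop :=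
  σ.toJordanDecomposition.posPart ≤ τ.toJordanDecomposition.posPart ∧
    σ.toJordanDecomposition.negPart ≤ τ.toJordanDecomposition.negPart

/-- The signed measure `ν - μ`. -/
def diffMeasure {m : ℕ} (μ ν : Measure (E m)) [IsFiniteMeasure μ] [IsFiniteMeasure ν] :
    SignedMeasure (E m) :=
  ν.toSignedMeasure - μ.toSignedMeasure

/-! ### Rectifiable 1-currents -/

/-- `N` is an embedded `1`-dimensional `C¹` submanifold of `ℝ^m` (not necessarily closed or
connected): near each of its points it is a regular `C¹` curve, parametrised homeomorphically. -/
def IsC1Curve {m : ℕ} (N : Set (E m)) : Prop :=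
  ∀ p ∈ N, ∃ (U : Set (E m)) (J : Set ℝ) (γ : ℝ → E m),
    IsOpen U ∧ p ∈ U ∧ IsOpen J ∧ ContDiffOn ℝ 1 γ J ∧ (∀ t ∈ J, deriv γ t ≠ 0) ∧
      γ '' J = N ∩ U ∧ IsEmbedding (J.domRestrict γ)

/-- Countably `1`-rectifiable subsets of `ℝ^m`. -/
def IsRectifiable {m : ℕ} (M : Set (E m)) : Prop :=
  ∃ (M₀ : Set (E m)) (N : ℕ → Set (E m)), Measure.hausdorffMeasure 1 M₀ = 0 ∧
    (∀ i, IsC1Curve (N i)) ∧ M ⊆ M₀ ∪ ⋃ i, N i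

/-- `T = τ(M, θ, ξ)`: the `1`-current `T` is carried by the rectifiable set `M` with multiplicity
`θ` and orientation `ξ`. The orientation is a unit tangent field in the sense that, for every
`C¹` submanifold `N`, it is tangent to `N` at almost every point of `M ∩ N`. -/
structure IsTau {m : ℕ} (M : Set (E m)) (θ : E m → ℝ) (ξ : E m → E m)
    (T : OneCurrent m) : Prop where
  measurable : NullMeasurableSet M (Measure.hausdorffMeasure 1)
  rectifiable : IsRectifiable M
  mult_integrable : IntegrableOn θ M (Measure.hausdorffMeasure 1)
  mult_pos : ∀ x ∈ M, 0 < θ x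
  orient_measurable : AEStronglyMeasurable ξ ((Measure.hausdorffMeasure 1).restrict M)
  orient_unit : ∀ x ∈ M, ‖ξ x‖ = 1
  orient_tangent : ∀ N : Set (E m), IsC1Curve N →
    ∀ᵐ x ∂((Measure.hausdorffMeasure 1).restrict M), x ∈ N → ξ x ∈ tangentConeAt ℝ N x
  action : ∀ η : OneForm m, T η = ∫ x in M, η x (ξ x) * θ x ∂(Measure.hausdorffMeasure 1)

/-- Rectifiable `1`-currents in `ℝ^m` (with real multiplicity and finite mass). -/
def IsRectifiableCurrent {m : ℕ} (T : OneCurrent m) : Prop :=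
  ∃ (M : Set (E m)) (θ : E m → ℝ) (ξ : E m → E m), IsTau M θ ξ T

/-- `M_α(T) = ∫_M θ^α dH¹` for `T = τ(M, θ, ξ)`. A rectifiable current determines `M` and `θ` up
to `H¹`-null sets, so all representations give the same value and the infimum only selects it. -/
def MAlpha {m : ℕ} (α : ℝ) (T : OneCurrent m) : ℝ≥0∞ :=
  ⨅ (M : Set (E m)) (θ : E m → ℝ) (ξ : E m → E m) (_ : IsTau M θ ξ T),
    ∫⁻ x in M, ENNReal.ofReal (θ x ^ α) ∂(Measure.hausdorffMeasure 1)

/-! ### Ramified transport and the problem with constant boundary payoff -/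

/-- `Path(μ, ν)`: rectifiable `1`-currents with `∂T = ν - μ`. -/
def Path {m : ℕ} (μ ν : Measure (E m)) [IsFiniteMeasure μ] [IsFiniteMeasure ν] :
    Set (OneCurrent m) :=
  {T | IsRectifiableCurrent T ∧ boundary T = ofSigned (diffMeasure μ ν)}

/-- `d_α(μ, ν)`, the least `M_α`-cost of a transport path from `μ` to `ν`. -/
def dAlpha {m : ℕ} (α : ℝ) (μ ν : Measure (E m)) [IsFiniteMeasure μ] [IsFiniteMeasure ν] :
    ℝ≥0∞ :=
  ⨅ T ∈ Path μ ν, MAlpha α T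

/-- The competitors: rectifiable `1`-currents whose boundary is a signed measure with
`∂T ⪯ ν - μ`. -/
def Feasible {m : ℕ} (μ ν : Measure (E m)) [IsFiniteMeasure μ] [IsFiniteMeasure ν] :
    Set (OneCurrent m) :=
  {T | IsRectifiableCurrent T ∧
    ∃ σ : SignedMeasure (E m), boundary T = ofSigned σ ∧ Preceq σ (diffMeasure μ ν)}

/-- `E_α^c(T) = M_α(T) - c M(∂T)`; the value is `⊤` if `M_α(T) = ∞` and `M(∂T) < ∞`. -/
def energy {m : ℕ} (α c : ℝ) (T : OneCurrent m) : EReal :=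
  ((MAlpha α T : ℝ≥0∞) : EReal) - (c : EReal) * ((mass (boundary T) : ℝ≥0∞) : EReal)

/-- `T` solves the problem with parameter `c`: it minimises `E_α^c` among all competitors. -/
def IsSolution {m : ℕ} (α c : ℝ) (μ ν : Measure (E m)) [IsFiniteMeasure μ] [IsFiniteMeasure ν]
    (T : OneCurrent m) : Prop :=
  T ∈ Feasible μ ν ∧ ∀ S ∈ Feasible μ ν, energy α c T ≤ energy α c S

end Ramified

end

/-!
A rectifiable `1`-current `τ(M, θ, ξ)` is encoded by the vector field `V = θ ξ` on `M`, zero off `M`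
(`IsRectifiableField`); its `α`-mass is `∫ ‖V‖^α dH¹`. The tangent cone of an embedded `C¹` curve is
a line (`IsC1Curve.exists_tangentConeAt_eq_span`), so the requirement that `V` be tangent to every
such curve is linear, and countable sums of rectifiable fields are rectifiable fields
(`IsRectifiableField.tsum`). Since `t ↦ t^α` is subadditive, so is the `α`-mass.

Summing segments along the dyadic cubes gives, for a measure `a` on a fixed bounded set, a current
with boundary `a - a(ℝᵐ) δ₀` and `α`-mass at most `C a(ℝᵐ)^α`, where `C` is finite because
`α > 1 - 1/m` (`exists_field_to_origin`). In particular `d_α(μ, ν) < ∞`, and two measures of small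
equal mass can be joined at small cost (`exists_field_between`).

The monotonicity statements follow from adding the minimality inequalities for two parameters. For
the limits, write the part of `ν - μ` missing from the boundary of a solution `T` as `a - b` with
positive measures `a`, `b`; they have equal mass since a boundary has total charge zero. Because `ν`
and `μ` have disjoint compact supports, the mass of `ν - μ` is `ν(ℝᵐ) + μ(ℝᵐ)`, and comparing `T`
with transport paths yields `M_α(T) + c (a(ℝᵐ) + b(ℝᵐ)) ≤ d_α(μ, ν)`. Hence `a` and `b` have mass
`O(1/c)`, which is the convergence of the boundaries. Completing `T` by a cheap transport from `b`
to `a` gives a transport path, so `d_α(μ, ν) ≤ M_α(T) + O(c^(-α))`, which is the convergence of the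
`α`-masses; no lower semicontinuity is needed.
-/

namespace Ramified

variable {m : ℕ}

/-! ### Rectifiable currents as vector fields -/

/-- The tangent cone of an embedded `C¹` curve at one of its points is a line. It is contained in the
line only because the parametrisation is an embedding: pieces of the curve returning to the point
could otherwise add further directions. -/
theorem IsC1Curve.exists_tangentConeAt_eq_span {N : Set (E m)} (hN : IsC1Curve N) {x : E m}
    (hx : x ∈ N) :
    ∃ v : E m, tangentConeAt ℝ N x = (Submodule.span ℝ {v} : Set (E m)) := by
  obtain ⟨U, J, γ, hU, hxU, hJ, hγ, hγ', himg, hemb⟩ := hN x hx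
  obtain ⟨t, htJ, rfl⟩ : x ∈ γ '' J := himg ▸ ⟨hx, hxU⟩
  have hderiv : HasDerivAt γ (deriv γ t) t :=
    ((hγ.contDiffAt (hJ.mem_nhds htJ)).differentiableAt one_ne_zero).hasDerivAt
  refine ⟨deriv γ t, Subset.antisymm ?_ ?_⟩
  · -- The projection onto the orthogonal complement of `γ' t` has derivative zero along `N`,
    -- hence vanishes on the tangent cone.
    set K : Submodule ℝ (E m) := Submodule.span ℝ {deriv γ t}
    set P : E m →L[ℝ] E m := Kᗮ.starProjection
    have hnhds : 𝓝[N] (γ t) = map γ (𝓝[J] t) := by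
      have h1 := hemb.isInducing.map_nhds_eq ⟨t, htJ⟩
      rw [range_domRestrict, himg] at h1
      rw [← nhdsWithin_inter_of_mem' (mem_nhdsWithin_of_mem_nhds (hU.mem_nhds hxU))]
      have h2 : 𝓝[J] t = map ((↑) : J → ℝ) (𝓝 ⟨t, htJ⟩) := (map_nhds_subtype_val ⟨t, htJ⟩).symm
      rw [h2, map_map]
      exact h1.symm
    have hP : HasFDerivWithinAt P (0 : E m →L[ℝ] E m) N (γ t) := by
      rw [hasFDerivWithinAt_iff_isLittleO, hnhds, Asymptotics.isLittleO_map]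
      have h1 : HasDerivAt (fun s => P (γ s)) (P (deriv γ t)) t :=
        P.hasFDerivAt.comp_hasDerivAt t hderiv
      have h0 : P (deriv γ t) = 0 := by
        rw [Submodule.starProjection_apply_eq_zero_iff, Submodule.orthogonal_orthogonal]
        exact Submodule.mem_span_singleton_self _
      rw [h0, hasDerivAt_iff_isLittleO] at h1
      have h2 : (fun s => s - t) =O[𝓝 t] fun s => γ s - γ t :=
        by
        have h := (HasDerivAtFilter.isTheta_sub hderiv (hγ' t htJ)).2
        rw [prod_pure, Asymptotics.isBigO_map] at h
        exact h
      have h3 := (h1.trans_isBigO h2).mono (nhdsWithin_le_nhds (s := J))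
      exact h3.congr_left fun s => by simp
    intro v hv
    have h := hP.unique_on P.hasFDerivWithinAt hv
    have hv0 : P v = 0 := by simpa using h.symm
    rwa [Submodule.starProjection_apply_eq_zero_iff, Submodule.orthogonal_orthogonal] at hv0
  · intro v hv
    obtain ⟨a, rfl⟩ := Submodule.mem_span_singleton.1 hv
    have h1 := hderiv.hasFDerivAt.hasFDerivWithinAt (s := J) |>.mapsTo_tangent_cone
    have h2 : a ∈ tangentConeAt ℝ J t := by
      rw [tangentConeAt_of_mem_nhds (hJ.mem_nhds htJ)]; trivial
    have h3 := tangentConeAt_mono (𝕜 := ℝ) (x := γ t)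
      (show γ '' J ⊆ N from himg ▸ inter_subset_left) (h1 h2)
    simpa using h3

/-- A vector field encoding a rectifiable current: at `H¹`-almost every point where it does not
vanish, its norm is the multiplicity and its direction the orientation. -/
structure IsRectifiableField (V : E m → E m) : Prop where
  integrable : Integrable V (Measure.hausdorffMeasure 1)
  rectifiable : IsRectifiable (Function.support V)
  tangent : ∀ N : Set (E m), IsC1Curve N →
    ∀ᵐ x ∂(Measure.hausdorffMeasure 1), x ∈ N → V x ∈ tangentConeAt ℝ N x

/-- The `1`-current `η ↦ ∫ ⟨η, V⟩ dH¹`. It is the zero current (by convention) if `V` is not locally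
integrable. -/
noncomputable def fieldCurrent (V : E m → E m) : OneCurrent m :=
  TestFunction.integralAgainstBilinCLM (ContinuousLinearMap.id ℝ (E m →L[ℝ] ℝ))
    (Measure.hausdorffMeasure 1) V

theorem fieldCurrent_apply {V : E m → E m} (hV : Integrable V (Measure.hausdorffMeasure 1))
    (η : OneForm m) : fieldCurrent V η = ∫ x, η x (V x) ∂(Measure.hausdorffMeasure 1) := by
  rw [fieldCurrent, TestFunction.integralAgainstBilinCLM_eq_integral
    (hV.locallyIntegrable.locallyIntegrableOn _)]
  rfl

/-- The `α`-mass of the current carried by a vector field. -/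
noncomputable def fieldCost (α : ℝ) (V : E m → E m) : ℝ≥0∞ :=
  ∫⁻ x, ‖V x‖ₑ ^ α ∂(Measure.hausdorffMeasure 1)

theorem IsRectifiable.mono {M M' : Set (E m)} (h : IsRectifiable M) (hM : M' ⊆ M) :
    IsRectifiable M' := by
  obtain ⟨M₀, N, h0, hN, hs⟩ := h
  exact ⟨M₀, N, h0, hN, hM.trans hs⟩

theorem IsRectifiable.iUnion {ι : Type*} [Countable ι] {M : ι → Set (E m)}
    (h : ∀ i, IsRectifiable (M i)) : IsRectifiable (⋃ i, M i) := by
  choose M₀ N h0 hN hs using h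
  rcases isEmpty_or_nonempty ι with hι | hι
  · exact ⟨∅, fun _ => ∅, measure_empty, fun _ p hp => hp.elim, by simp⟩
  obtain ⟨e, he⟩ := exists_surjective_nat (ι × ℕ)
  refine ⟨⋃ i, M₀ i, fun n => N (e n).1 (e n).2, measure_iUnion_null h0, fun n => hN _ _, ?_⟩
  refine iUnion_subset fun i x hx => ?_
  rcases hs i hx with h | h
  · exact Or.inl (mem_iUnion.2 ⟨i, h⟩)
  · obtain ⟨k, hk⟩ := mem_iUnion.1 h
    obtain ⟨n, hn⟩ := he (i, k)
    exact Or.inr (mem_iUnion.2 ⟨n, by simpa [hn] using hk⟩)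

theorem IsC1Curve.isRectifiable {N : Set (E m)} (hN : IsC1Curve N) : IsRectifiable N :=
  ⟨∅, fun _ => N, measure_empty, fun _ => hN, by simp [iUnion_const]⟩

section Tsum

variable {ι : Type*} [Countable ι] {V : ι → E m → E m}

theorem ae_summable_norm (hV : ∀ i, AEStronglyMeasurable (V i) (Measure.hausdorffMeasure 1))
    (hsum : ∑' i, ∫⁻ x, ‖V i x‖ₑ ∂(Measure.hausdorffMeasure 1 : Measure (E m)) ≠ ⊤) :
    ∀ᵐ x ∂(Measure.hausdorffMeasure 1 : Measure (E m)), Summable fun i => ‖V i x‖ := by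
  refine summable_norm_of_tsum_eLpNorm_ne_top le_rfl hV ?_
  simpa only [eLpNorm_one_eq_lintegral_enorm] using hsum

theorem integrable_tsum_of_lintegral (hV : ∀ i, Integrable (V i) (Measure.hausdorffMeasure 1))
    (hsum : ∑' i, ∫⁻ x, ‖V i x‖ₑ ∂(Measure.hausdorffMeasure 1 : Measure (E m)) ≠ ⊤) :
    Integrable (fun x => ∑' i, V i x) (Measure.hausdorffMeasure 1) := by
  refine ⟨aestronglyMeasurable_of_tendsto_ae (atTop : Filter (Finset ι))
    (f := fun s x => ∑ i ∈ s, V i x)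
    (fun s => s.aestronglyMeasurable_fun_sum fun i _ => (hV i).1) ?_, ?_⟩
  · filter_upwards [ae_summable_norm (fun i => (hV i).1) hsum] with x hx
    exact hx.of_norm.hasSum
  · refine lt_of_le_of_lt (lintegral_mono fun x => enorm_tsum_le_tsum_enorm) ?_
    rw [lintegral_tsum fun i => (hV i).1.enorm]
    exact hsum.lt_top

/-- A countable sum of tangent fields is tangent, because the tangent cones of a `C¹` curve are
lines; so the sum is again a rectifiable field, and no cancellation has to be analysed. -/
theorem IsRectifiableField.tsum (hV : ∀ i, IsRectifiableField (V i))
    (hsum : ∑' i, ∫⁻ x, ‖V i x‖ₑ ∂(Measure.hausdorffMeasure 1 : Measure (E m)) ≠ ⊤) :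
    IsRectifiableField (fun x => ∑' i, V i x) where
  integrable := integrable_tsum_of_lintegral (fun i => (hV i).integrable) hsum
  rectifiable := by
    refine (IsRectifiable.iUnion fun i => (hV i).rectifiable).mono fun x hx => ?_
    by_contra hcon
    simp only [mem_iUnion, Function.mem_support, not_exists, not_not] at hcon
    exact hx (by simp [hcon])
  tangent := by
    intro N hN
    filter_upwards [ae_all_iff.2 fun i => (hV i).tangent N hN] with x hx hxN
    obtain ⟨v, hv⟩ := hN.exists_tangentConeAt_eq_span hxN
    simp only [hv] at hx ⊢
    exact tsum_mem (S := Submodule ℝ (E m)) (Submodule.closed_of_finiteDimensional _)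
      fun i => hx i hxN

theorem OneForm.exists_norm_le (η : OneForm m) : ∃ C : ℝ, 0 ≤ C ∧ ∀ x, ‖η x‖ ≤ C := by
  obtain ⟨C, hC⟩ := η.hasCompactSupport.exists_bound_of_continuous η.contDiff.continuous
  exact ⟨C, (norm_nonneg _).trans (hC 0), hC⟩

theorem hasSum_fieldCurrent (hV : ∀ i, Integrable (V i) (Measure.hausdorffMeasure 1))
    (hsum : ∑' i, ∫⁻ x, ‖V i x‖ₑ ∂(Measure.hausdorffMeasure 1 : Measure (E m)) ≠ ⊤)
    (η : OneForm m) :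
    HasSum (fun i => fieldCurrent (V i) η) (fieldCurrent (fun x => ∑' i, V i x) η) := by
  obtain ⟨C, hC, hη⟩ := η.exists_norm_le
  have hηc : Continuous η := η.contDiff.continuous
  rw [fieldCurrent_apply (integrable_tsum_of_lintegral hV hsum)]
  simp_rw [fun i => fieldCurrent_apply (hV i) η]
  have hae := ae_summable_norm (fun i => (hV i).1) hsum
  refine hasSum_integral_of_dominated_convergence (fun i x => C * ‖V i x‖)
    (fun i => ?_) (fun i => ae_of_all _ fun x => ?_) ?_ ?_ ?_
  · exact (ContinuousLinearMap.id ℝ (E m →L[ℝ] ℝ)).aestronglyMeasurable_comp₂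
      hηc.aestronglyMeasurable (hV i).1
  · exact (η x).le_of_opNorm_le (hη x) _
  · filter_upwards [hae] with x hx using hx.mul_left C
  · simp_rw [tsum_mul_left]
    refine Integrable.const_mul ⟨?_, ?_⟩ C
    · refine aestronglyMeasurable_of_tendsto_ae (atTop : Filter (Finset ι))
        (f := fun s x => ∑ i ∈ s, ‖V i x‖)
        (fun s => s.aestronglyMeasurable_fun_sum fun i _ => (hV i).1.norm) ?_
      filter_upwards [hae] with x hx using hx.hasSum
    · refine lt_of_le_of_lt (lintegral_mono fun x => enorm_tsum_le_tsum_enorm) ?_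
      simp_rw [enorm_norm]
      rw [lintegral_tsum fun i => (hV i).1.enorm]
      exact hsum.lt_top
  · filter_upwards [hae] with x hx
    exact (η x).hasSum hx.of_norm.hasSum

theorem rpow_tsum_le_tsum_rpow {ι : Type*} {α : ℝ} (hα : 0 < α) (hα1 : α ≤ 1) (f : ι → ℝ≥0∞) :
    (∑' i, f i) ^ α ≤ ∑' i, f i ^ α := by
  have hfin : ∀ s : Finset ι, (∑ i ∈ s, f i) ^ α ≤ ∑ i ∈ s, f i ^ α := by
    classical
    intro s
    induction s using Finset.induction_on with
    | empty => simp [hα]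
    | insert i s hi ih =>
      rw [Finset.sum_insert hi, Finset.sum_insert hi]
      exact (ENNReal.rpow_add_le_add_rpow _ _ hα.le hα1).trans (by gcongr)
  have h : Tendsto (fun s : Finset ι => (∑ i ∈ s, f i) ^ α) atTop (𝓝 ((∑' i, f i) ^ α)) :=
    (ENNReal.continuous_rpow_const.tendsto _).comp ENNReal.summable.hasSum
  exact le_of_tendsto h (.of_forall fun s => (hfin s).trans (ENNReal.sum_le_tsum s))

theorem fieldCost_tsum_le {α : ℝ} (hα : 0 < α) (hα1 : α ≤ 1)
    (hV : ∀ i, AEStronglyMeasurable (V i) (Measure.hausdorffMeasure 1)) :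
    fieldCost α (fun x => ∑' i, V i x) ≤ ∑' i, fieldCost α (V i) := by
  unfold fieldCost
  rw [← lintegral_tsum fun i => (hV i).enorm.pow_const α]
  refine lintegral_mono fun x => ?_
  exact (ENNReal.rpow_le_rpow enorm_tsum_le_tsum_enorm hα.le).trans (rpow_tsum_le_tsum_rpow hα hα1 _)

end Tsum

theorem IsRectifiableField.neg {V : E m → E m} (hV : IsRectifiableField V) :
    IsRectifiableField (fun x => -V x) where
  integrable := hV.integrable.neg
  rectifiable := by simpa [Function.support_fun_neg] using hV.rectifiable
  tangent := by
    intro N hN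
    filter_upwards [hV.tangent N hN] with x hx hxN
    obtain ⟨v, hv⟩ := hN.exists_tangentConeAt_eq_span hxN
    rw [hv] at hx ⊢
    exact Submodule.neg_mem _ (hx hxN)

theorem fieldCurrent_neg {V : E m → E m} (hV : Integrable V (Measure.hausdorffMeasure 1)) :
    fieldCurrent (fun x => -V x) = -fieldCurrent V := by
  ext η
  have h := fieldCurrent_apply hV.neg η
  simp only [Pi.neg_apply, map_neg, integral_neg] at h
  rw [neg_apply, fieldCurrent_apply hV]
  exact h

theorem fieldCost_neg (α : ℝ) (V : E m → E m) : fieldCost α (fun x => -V x) = fieldCost α V := by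
  simp [fieldCost]

theorem isRectifiableField_zero : IsRectifiableField (fun _ : E m => (0 : E m)) where
  integrable := integrable_zero _ _ _
  rectifiable := (IsRectifiable.iUnion (M := fun i : Empty => i.elim) fun i => i.elim).mono
    (by simp)
  tangent := by
    intro N hN
    refine ae_of_all _ fun x hxN => ?_
    obtain ⟨v, hv⟩ := hN.exists_tangentConeAt_eq_span hxN
    rw [hv]
    exact Submodule.zero_mem _

theorem IsRectifiableField.isTau {V : E m → E m} (hV : IsRectifiableField V) :
    IsTau (Function.support V) (fun x => ‖V x‖) (fun x => ‖V x‖⁻¹ • V x) (fieldCurrent V) := by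
  have hmeas : AEStronglyMeasurable (fun x => ‖V x‖⁻¹) (Measure.hausdorffMeasure 1) :=
    hV.integrable.1.norm.aemeasurable.inv.aestronglyMeasurable
  have hsupp : NullMeasurableSet (Function.support V) (Measure.hausdorffMeasure 1) := by
    have h : MeasurableSet ({0}ᶜ : Set (E m)) := (measurableSet_singleton 0).compl
    have h2 := hV.integrable.1.aemeasurable.nullMeasurableSet_preimage h
    rwa [show Function.support V = V ⁻¹' {0}ᶜ from rfl]
  refine ⟨hsupp, hV.rectifiable, hV.integrable.norm.integrableOn,
    fun x hx => norm_pos_iff.2 hx, (hmeas.smul hV.integrable.1).restrict, fun x hx => ?_,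
    fun N hN => ae_restrict_of_ae ?_, fun η => ?_⟩
  · rw [norm_smul, norm_inv, norm_norm, inv_mul_cancel₀ (norm_ne_zero_iff.2 hx)]
  · filter_upwards [hV.tangent N hN] with x hx hxN
    obtain ⟨v, hv⟩ := hN.exists_tangentConeAt_eq_span hxN
    rw [hv] at hx ⊢
    exact Submodule.smul_mem _ _ (hx hxN)
  · rw [fieldCurrent_apply hV.integrable, setIntegral_eq_integral_of_forall_compl_eq_zero]
    · refine integral_congr_ae (ae_of_all _ fun x => ?_)
      by_cases hx : V x = 0
      · simp [hx]
      · have : ‖V x‖ ≠ 0 := norm_ne_zero_iff.2 hx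
        simp only [map_smul, smul_eq_mul]
        field_simp
    · intro x hx
      simp [Function.notMem_support.1 hx]

theorem IsRectifiableField.isRectifiableCurrent {V : E m → E m} (hV : IsRectifiableField V) :
    IsRectifiableCurrent (fieldCurrent V) :=
  ⟨_, _, _, hV.isTau⟩

theorem IsRectifiableField.mAlpha_le {V : E m → E m} (hV : IsRectifiableField V) {α : ℝ}
    (hα : 0 < α) : MAlpha α (fieldCurrent V) ≤ fieldCost α V := by
  unfold MAlpha
  refine (iInf_le _ (Function.support V)).trans ?_
  refine (iInf_le _ fun x => ‖V x‖).trans ?_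
  refine (iInf_le _ fun x => ‖V x‖⁻¹ • V x).trans ?_
  refine (iInf_le _ hV.isTau).trans ?_
  refine (setLIntegral_le_lintegral _ _).trans (lintegral_mono fun x => ?_)
  rw [← ENNReal.ofReal_rpow_of_nonneg (norm_nonneg _) hα.le, ofReal_norm]

theorem IsTau.exists_field {M : Set (E m)} {θ : E m → ℝ} {ξ : E m → E m} {T : OneCurrent m}
    (h : IsTau M θ ξ T) {α : ℝ} (hα : 0 < α) :
    ∃ V : E m → E m, IsRectifiableField V ∧ T = fieldCurrent V ∧
      fieldCost α V = ∫⁻ x in M, ENNReal.ofReal (θ x ^ α) ∂(Measure.hausdorffMeasure 1) := by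
  have hM := h.measurable
  have hint : IntegrableOn (fun x => θ x • ξ x) M (Measure.hausdorffMeasure 1) := by
    refine Integrable.mono h.mult_integrable (h.mult_integrable.1.smul h.orient_measurable) ?_
    refine (ae_restrict_iff'₀ hM).2 (ae_of_all _ fun x hx => ?_)
    rw [norm_smul, h.orient_unit x hx, mul_one]
  have hV : Integrable (M.indicator fun x => θ x • ξ x) (Measure.hausdorffMeasure 1) := by
    refine ⟨(aestronglyMeasurable_indicator_iff₀ hM).2 hint.1, ?_⟩
    simp only [HasFiniteIntegral, enorm_indicator_eq_indicator_enorm]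
    rw [lintegral_indicator₀ hM]
    exact hint.2
  refine ⟨M.indicator fun x => θ x • ξ x, ⟨hV, h.rectifiable.mono support_indicator_subset, ?_⟩,
    ?_, ?_⟩
  · intro N hN
    filter_upwards [(ae_restrict_iff'₀ hM).1 (h.orient_tangent N hN)] with x hx hxN
    obtain ⟨v, hv⟩ := hN.exists_tangentConeAt_eq_span hxN
    rw [hv] at hx ⊢
    by_cases hxM : x ∈ M
    · rw [indicator_of_mem hxM]
      exact Submodule.smul_mem _ _ (hx hxM hxN)
    · rw [indicator_of_notMem hxM]
      exact Submodule.zero_mem _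
  · ext η
    rw [fieldCurrent_apply hV, h.action, ← integral_indicator₀ hM]
    refine integral_congr_ae (ae_of_all _ fun x => ?_)
    by_cases hxM : x ∈ M <;> simp [hxM, mul_comm]
  · rw [fieldCost, ← lintegral_indicator₀ hM]
    refine lintegral_congr fun x => ?_
    by_cases hxM : x ∈ M
    · simp only [indicator_of_mem hxM]
      rw [enorm_smul, ← ofReal_norm (ξ x), h.orient_unit x hxM, ENNReal.ofReal_one, mul_one,
        ← ofReal_norm, Real.norm_of_nonneg (h.mult_pos x hxM).le,
        ENNReal.ofReal_rpow_of_nonneg (h.mult_pos x hxM).le hα.le]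
    · simp [hxM, hα]

theorem exists_field_of_mAlpha_lt {α : ℝ} (hα : 0 < α) {T : OneCurrent m} {B : ℝ≥0∞}
    (h : MAlpha α T < B) :
    ∃ V : E m → E m, IsRectifiableField V ∧ T = fieldCurrent V ∧ fieldCost α V < B := by
  simp only [MAlpha, iInf_lt_iff] at h
  obtain ⟨M, θ, ξ, hτ, hlt⟩ := h
  obtain ⟨V, hV, hT, hcost⟩ := hτ.exists_field hα
  exact ⟨V, hV, hT, hcost ▸ hlt⟩

theorem IsRectifiableCurrent.exists_field {T : OneCurrent m} (h : IsRectifiableCurrent T) :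
    ∃ V : E m → E m, IsRectifiableField V ∧ T = fieldCurrent V := by
  obtain ⟨M, θ, ξ, hτ⟩ := h
  obtain ⟨V, hV, hT, -⟩ := hτ.exists_field one_pos
  exact ⟨V, hV, hT⟩

theorem IsRectifiableField.add {V W : E m → E m} (hV : IsRectifiableField V)
    (hW : IsRectifiableField W) :
    IsRectifiableField (fun x => V x + W x) ∧
      fieldCurrent (fun x => V x + W x) = fieldCurrent V + fieldCurrent W ∧
      ∀ α : ℝ, 0 < α → α ≤ 1 →
        fieldCost α (fun x => V x + W x) ≤ fieldCost α V + fieldCost α W := by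
  let F : Bool → E m → E m := fun b => cond b V W
  have hF : ∀ b, IsRectifiableField (F b) := by rintro (_ | _); exacts [hW, hV]
  have hsum : ∑' b, ∫⁻ x, ‖F b x‖ₑ ∂(Measure.hausdorffMeasure 1 : Measure (E m)) ≠ ⊤ := by
    rw [tsum_bool]
    exact ENNReal.add_ne_top.2 ⟨hW.integrable.2.ne, hV.integrable.2.ne⟩
  have heq : (fun x => ∑' b, F b x) = fun x => V x + W x := by
    ext1 x; rw [tsum_bool, add_comm]; rfl
  refine ⟨heq ▸ IsRectifiableField.tsum hF hsum, ?_, fun α hα hα1 => ?_⟩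
  · ext η
    have h := (hasSum_fieldCurrent (fun b => (hF b).integrable) hsum η).tsum_eq
    rw [heq, tsum_bool] at h
    rw [← h, add_apply, add_comm]; rfl
  · have h := fieldCost_tsum_le hα hα1 (fun b => (hF b).integrable.1)
    rwa [heq, tsum_bool, add_comm] at h

/-! ### Segments -/

section Line

variable {u : E m}

theorem isometry_line (hu : ‖u‖ = 1) (p : E m) : Isometry fun t : ℝ => p + t • u := by
  refine Isometry.of_dist_eq fun s t => ?_
  rw [dist_add_left, dist_eq_norm, ← sub_smul, norm_smul, hu, mul_one, Real.dist_eq,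
    Real.norm_eq_abs]

theorem hasDerivAt_line (p u : E m) (t : ℝ) : HasDerivAt (fun t : ℝ => p + t • u) u t := by
  simpa using ((hasDerivAt_id t).smul_const u).const_add p

theorem isC1Curve_line (hu : ‖u‖ = 1) (p : E m) {J : Set ℝ} (hJ : IsOpen J) :
    IsC1Curve ((fun t : ℝ => p + t • u) '' J) := by
  intro x hx
  refine ⟨univ, J, fun t => p + t • u, isOpen_univ, mem_univ _, hJ, ?_, fun t _ => ?_,
    (inter_univ _).symm, ?_⟩
  · exact (contDiff_const.add (contDiff_id.smul contDiff_const)).contDiffOn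
  · rw [(hasDerivAt_line p u t).deriv]
    exact norm_ne_zero_iff.1 (by rw [hu]; exact one_ne_zero)
  · exact (isometry_line hu p).isEmbedding.comp IsEmbedding.subtypeVal

/-- Almost every point of a set `A` of reals is an accumulation point of `A`, so a line is tangent
to any set at almost every common point. -/
theorem ae_mem_tangentConeAt_line (hu : ‖u‖ = 1) (p : E m) (N : Set (E m)) :
    ∀ᵐ x ∂(Measure.hausdorffMeasure 1 : Measure (E m)), x ∈ N →
      x ∈ range (fun t : ℝ => p + t • u) → u ∈ tangentConeAt ℝ N x := by
  set l : ℝ → E m := fun t => p + t • u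
  set A : Set ℝ := l ⁻¹' N
  have hcount : {t ∈ A | 𝓝[A ∩ Ioi t] t = ⊥}.Countable :=
    countable_setOfPred_isolated_right_within
  have hnull : (Measure.hausdorffMeasure 1 : Measure (E m))
      (l '' {t ∈ A | 𝓝[A ∩ Ioi t] t = ⊥}) = 0 := by
    rw [(isometry_line hu p).hausdorffMeasure_image (Or.inl zero_le_one),
      hausdorffMeasure_real]
    exact hcount.measure_zero _
  filter_upwards [measure_eq_zero_iff_ae_notMem.1 hnull] with x hx hxN hxl
  obtain ⟨t, rfl⟩ := hxl
  have hne : 𝓝[A ∩ Ioi t] t ≠ ⊥ := fun h => hx ⟨t, ⟨hxN, h⟩, rfl⟩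
  have hacc : AccPt t (𝓟 A) := by
    rw [accPt_principal_iff_nhdsWithin]
    exact NeBot.mono ⟨hne⟩ (nhdsWithin_mono _ fun s hs => ⟨hs.1, ne_of_gt hs.2⟩)
  have h1 := (hasDerivAt_line p u t).hasFDerivAt.hasFDerivWithinAt (s := A) |>.mapsTo_tangent_cone
  have h2 : (1 : ℝ) ∈ tangentConeAt ℝ A t := by
    rw [tangentConeAt_eq_univ hacc]; trivial
  have h3 := tangentConeAt_mono (𝕜 := ℝ) (x := l t) (image_preimage_subset l N) (h1 h2)
  simpa using h3

end Line

/-- The oriented segment from `p` to `q` with multiplicity `w`, as a rectifiable field. -/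
theorem exists_segment_field (p q : E m) (w : ℝ) (hw : 0 ≤ w) :
    ∃ V : E m → E m, IsRectifiableField V ∧
      (∀ α : ℝ, 0 < α → fieldCost α V ≤ ENNReal.ofReal w ^ α * ENNReal.ofReal ‖q - p‖) ∧
      ∀ φ : ZeroForm m, fieldCurrent V (extDeriv φ) = w * (φ q - φ p) := by
  rcases eq_or_ne p q with rfl | hpq
  · refine ⟨fun _ => 0, isRectifiableField_zero, fun α hα => ?_, fun φ => ?_⟩
    · simp [fieldCost, hα]
    · rw [fieldCurrent_apply isRectifiableField_zero.integrable]
      simp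
  have hL : 0 < ‖q - p‖ := norm_pos_iff.2 (sub_ne_zero.2 hpq.symm)
  set L := ‖q - p‖
  set u : E m := L⁻¹ • (q - p) with hu_def
  have hu : ‖u‖ = 1 := by
    rw [hu_def, norm_smul, norm_inv, Real.norm_of_nonneg hL.le, inv_mul_cancel₀ hL.ne']
  set l : ℝ → E m := fun t => p + t • u with hl
  have hiso : Isometry l := isometry_line hu p
  have hemb : MeasurableEmbedding l := hiso.isClosedEmbedding.measurableEmbedding
  set S : Set (E m) := l '' Ioo 0 L
  have hS : MeasurableSet S := hemb.measurableSet_image.2 measurableSet_Ioo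
  have hSmeas : (Measure.hausdorffMeasure 1 : Measure (E m)) S = ENNReal.ofReal L := by
    rw [hiso.hausdorffMeasure_image (Or.inl zero_le_one), hausdorffMeasure_real, Real.volume_Ioo,
      sub_zero]
  have hint : Integrable (S.indicator fun _ => w • u) (Measure.hausdorffMeasure 1) := by
    rw [integrable_indicator_iff hS]
    exact integrableOn_const (by rw [hSmeas]; exact ENNReal.ofReal_ne_top)
  refine ⟨S.indicator fun _ => w • u, ⟨hint,
    (isC1Curve_line hu p isOpen_Ioo).isRectifiable.mono support_indicator_subset, ?_⟩, ?_, ?_⟩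
  · intro N hN
    filter_upwards [ae_mem_tangentConeAt_line hu p N] with x hx hxN
    obtain ⟨v, hv⟩ := hN.exists_tangentConeAt_eq_span hxN
    rw [hv] at hx ⊢
    by_cases hxS : x ∈ S
    · rw [indicator_of_mem hxS]
      exact Submodule.smul_mem _ _ (hx hxN (image_subset_range _ _ hxS))
    · rw [indicator_of_notMem hxS]
      exact Submodule.zero_mem _
  · intro α hα
    have h : ∀ x, ‖S.indicator (fun _ => w • u) x‖ₑ ^ α
        = S.indicator (fun _ => ENNReal.ofReal w ^ α) x := by
      intro x
      by_cases hxS : x ∈ S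
      · rw [indicator_of_mem hxS, indicator_of_mem hxS, ← ofReal_norm, norm_smul, hu, mul_one,
          Real.norm_of_nonneg hw]
      · simp [hxS, hα]
    rw [fieldCost]
    simp_rw [h]
    rw [lintegral_indicator_const hS, hSmeas]
  · intro φ
    have hφ : ContDiff ℝ ∞ φ := φ.contDiff
    have hd : ∀ t, HasDerivAt (fun t => φ (l t)) (fderiv ℝ φ (l t) u) t := fun t =>
      ((hφ.differentiable (by simp)).differentiableAt.hasFDerivAt).comp_hasDerivAt t
        (hasDerivAt_line p u t)
    have hlc : Continuous l := hiso.continuous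
    have hcont : Continuous fun t => fderiv ℝ φ (l t) u :=
      ((hφ.continuous_fderiv (by simp)).comp hlc).clm_apply continuous_const
    have hpt : ∀ x, extDeriv φ x (S.indicator (fun _ => w • u) x)
        = S.indicator (fun x => w * fderiv ℝ φ x u) x := by
      intro x
      by_cases hxS : x ∈ S <;> simp [hxS, extDeriv_apply]
    rw [fieldCurrent_apply hint]
    simp_rw [hpt]
    rw [integral_indicator hS, ← Measure.restrict_restrict_of_subset (image_subset_range l _),
      ← hiso.map_hausdorffMeasure (Or.inl zero_le_one), hemb.setIntegral_map,
      hiso.injective.preimage_image, hausdorffMeasure_real, integral_const_mul,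
      ← integral_Ioc_eq_integral_Ioo, ← intervalIntegral.integral_of_le hL.le,
      intervalIntegral.integral_eq_sub_of_hasDerivAt (fun t _ => hd t)
        (hcont.intervalIntegrable _ _)]
    have h1 : l L = q := by
      rw [hl, hu_def]
      simp only [smul_inv_smul₀ hL.ne']
      abel
    have h0 : l 0 = p := by simp [hl]
    rw [h1, h0]

/-! ### Countable sums of segments -/

/-- A countable family of weighted segments of finite total length is carried by one rectifiable
field, whose boundary is the sum of the boundaries. -/
theorem exists_field_of_segments {ι : Type*} [Countable ι] (p q : ι → E m) (w : ι → ℝ)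
    (hw : ∀ i, 0 ≤ w i)
    (hfin : ∑' i, ENNReal.ofReal (w i) * ENNReal.ofReal ‖q i - p i‖ ≠ ⊤) :
    ∃ V : E m → E m, IsRectifiableField V ∧
      (∀ α : ℝ, 0 < α → α ≤ 1 →
        fieldCost α V ≤ ∑' i, ENNReal.ofReal (w i) ^ α * ENNReal.ofReal ‖q i - p i‖) ∧
      ∀ φ : ZeroForm m,
        HasSum (fun i => w i * (φ (q i) - φ (p i))) (fieldCurrent V (extDeriv φ)) := by
  choose V hV hcost hbd using fun i => exists_segment_field (p i) (q i) (w i) (hw i)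
  have hsum : ∑' i, ∫⁻ x, ‖V i x‖ₑ ∂(Measure.hausdorffMeasure 1 : Measure (E m)) ≠ ⊤ := by
    refine ne_top_of_le_ne_top hfin (ENNReal.tsum_le_tsum fun i => ?_)
    simpa [fieldCost] using hcost i 1 one_pos
  refine ⟨fun x => ∑' i, V i x, IsRectifiableField.tsum hV hsum, fun α hα hα1 => ?_, fun φ => ?_⟩
  · exact (fieldCost_tsum_le hα hα1 fun i => (hV i).integrable.1).trans
      (ENNReal.tsum_le_tsum fun i => hcost i α hα)
  · simpa only [hbd] using hasSum_fieldCurrent (fun i => (hV i).integrable) hsum (extDeriv φ)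

/-- Concavity of `t ↦ t^α`: splitting a mass into `N` parts raises `∑ w^α` at most by the factor
`N^(1 - α)`. -/
theorem sum_rpow_le_card_rpow_mul {ι : Type*} {α : ℝ} (hα : 0 < α) (hα1 : α ≤ 1)
    (s : Finset ι) (f : ι → ℝ≥0∞) :
    ∑ i ∈ s, f i ^ α ≤ (s.card : ℝ≥0∞) ^ (1 - α) * (∑ i ∈ s, f i) ^ α := by
  have h := ENNReal.rpow_sum_le_const_mul_sum_rpow s (fun i => f i ^ α) (one_le_inv₀ hα |>.2 hα1)
  simp_rw [ENNReal.rpow_rpow_inv hα.ne'] at h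
  have h2 := ENNReal.rpow_le_rpow h hα.le
  rw [ENNReal.rpow_inv_rpow hα.ne', ENNReal.mul_rpow_of_nonneg _ _ hα.le, ← ENNReal.rpow_mul] at h2
  rwa [sub_mul, inv_mul_cancel₀ hα.ne', one_mul] at h2

/-! ### Dyadic transport of a measure to the origin -/

/-- The index of the half-open dyadic cube of side `2⁻ⁿ` containing `x`. -/
noncomputable def dyadicIndex (n : ℕ) (x : E m) : Fin m → ℤ := fun i => ⌊2 ^ n * x i⌋

/-- The lowest corner of the dyadic cube of side `2⁻ⁿ` with index `k`. -/
noncomputable def dyadicPoint (n : ℕ) (k : Fin m → ℤ) : E m :=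
  WithLp.toLp 2 fun i => (k i : ℝ) / 2 ^ n

/-- The corner of the parent of the dyadic cube of side `2⁻ⁿ` with index `k`; the cubes of side `1`
have the origin as their parent. -/
noncomputable def dyadicParent : ℕ → (Fin m → ℤ) → E m
  | 0, _ => 0
  | n + 1, k => dyadicPoint n fun i => k i / 2

/-- The indices of the dyadic cubes of side `2⁻ⁿ` meeting the cube `[-R, R]ᵐ`. -/
noncomputable def dyadicBox (m R n : ℕ) : Finset (Fin m → ℤ) :=
  Fintype.piFinset fun _ => Finset.Icc (-((R * 2 ^ n : ℕ) : ℤ)) (R * 2 ^ n : ℕ)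

theorem dyadicIndex_mem_dyadicBox {R n : ℕ} {x : E m} (hx : ∀ i, |x i| ≤ (R : ℝ)) :
    dyadicIndex n x ∈ dyadicBox m R n := by
  refine Fintype.mem_piFinset.2 fun i => Finset.mem_Icc.2 ?_
  have h2 : (0 : ℝ) < 2 ^ n := by positivity
  obtain ⟨h3, h4⟩ := abs_le.1 (hx i)
  constructor
  · refine Int.le_floor.2 ?_
    push_cast
    nlinarith
  · refine Int.floor_le_iff.2 ?_
    push_cast
    nlinarith

theorem card_dyadicBox (m R n : ℕ) : (dyadicBox m R n).card = (2 * (R * 2 ^ n) + 1) ^ m := by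
  rw [dyadicBox, Fintype.card_piFinset_const, Int.card_Icc]
  congr 1
  omega

theorem norm_le_sqrt_mul (v : E m) {B : ℝ} (hB : 0 ≤ B) (h : ∀ i, |v i| ≤ B) :
    ‖v‖ ≤ √m * B := by
  rw [EuclideanSpace.norm_eq, ← Real.sqrt_sq hB, ← Real.sqrt_mul (Nat.cast_nonneg m)]
  refine Real.sqrt_le_sqrt ((Finset.sum_le_card_nsmul _ _ (B ^ 2) fun i _ => ?_).trans (by simp))
  rw [Real.norm_eq_abs]
  exact pow_le_pow_left₀ (abs_nonneg _) (h i) 2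

theorem norm_dyadicPoint_sub_dyadicParent_le {R n : ℕ} (hR : 1 ≤ R) {k : Fin m → ℤ}
    (hk : k ∈ dyadicBox m R n) :
    ‖dyadicPoint n k - dyadicParent n k‖ ≤ √m * (R / 2 ^ n) := by
  refine norm_le_sqrt_mul _ (by positivity) fun i => ?_
  rcases n with _ | n
  · have h := Finset.mem_Icc.1 (Fintype.mem_piFinset.1 hk i)
    simp only [pow_zero, mul_one] at h
    simp only [dyadicPoint, dyadicParent, sub_zero, pow_zero, div_one]
    rw [abs_le]
    exact ⟨by exact_mod_cast h.1, by exact_mod_cast h.2⟩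
  · have h1 : (k i : ℝ) = 2 * ((k i / 2 : ℤ) : ℝ) + ((k i % 2 : ℤ) : ℝ) := by
      exact_mod_cast (Int.mul_ediv_add_emod (k i) 2).symm
    have h2 : (dyadicPoint (n + 1) k - dyadicParent (n + 1) k) i
        = ((k i % 2 : ℤ) : ℝ) / 2 ^ (n + 1) := by
      simp only [dyadicPoint, dyadicParent, PiLp.sub_apply]
      rw [h1, pow_succ]
      field_simp
      ring
    have h3 : ((k i % 2 : ℤ) : ℝ) ≤ R := by
      have : k i % 2 ≤ R := by omega
      exact_mod_cast this
    have h4 : (0 : ℝ) ≤ ((k i % 2 : ℤ) : ℝ) := by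
      exact_mod_cast Int.emod_nonneg _ two_ne_zero
    rw [h2, abs_of_nonneg (by positivity)]
    gcongr

theorem dyadicParent_dyadicIndex_succ (n : ℕ) (x : E m) :
    dyadicParent (n + 1) (dyadicIndex (n + 1) x) = dyadicPoint n (dyadicIndex n x) := by
  have h : (fun i => dyadicIndex (n + 1) x i / 2) = dyadicIndex n x := by
    ext i
    have h := Int.floor_div_natCast (2 ^ (n + 1) * x i) 2
    simp only [dyadicIndex]
    rw [pow_succ] at h ⊢
    rw [show (2 : ℤ) = ((2 : ℕ) : ℤ) from rfl, ← h]
    congr 1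
    push_cast
    ring
  rw [dyadicParent, h]

theorem tendsto_dyadicPoint_dyadicIndex (x : E m) :
    Tendsto (fun n => dyadicPoint n (dyadicIndex n x)) atTop (𝓝 x) := by
  rw [tendsto_iff_norm_sub_tendsto_zero]
  have h : Tendsto (fun n : ℕ => √m * (1 / 2 : ℝ) ^ n) atTop (𝓝 0) := by
    simpa using (tendsto_pow_atTop_nhds_zero_of_lt_one (by norm_num : (0 : ℝ) ≤ 1 / 2)
      (by norm_num)).const_mul (√m)
  refine squeeze_zero (fun n => norm_nonneg _) (fun n => ?_) h
  refine norm_le_sqrt_mul _ (by positivity) fun i => ?_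
  have h2 : (0 : ℝ) < 2 ^ n := by positivity
  have h1 : (dyadicPoint n (dyadicIndex n x) - x) i
      = -(Int.fract (2 ^ n * x i) / 2 ^ n) := by
    simp only [dyadicPoint, dyadicIndex, PiLp.sub_apply, Int.fract]
    field_simp
    ring
  rw [h1, abs_neg, abs_of_nonneg (div_nonneg (Int.fract_nonneg _) h2.le), one_div, inv_pow,
    ← one_div]
  gcongr
  exact (Int.fract_lt_one _).le

theorem measurable_dyadicIndex (n : ℕ) : Measurable (dyadicIndex n : E m → Fin m → ℤ) := by
  refine measurable_pi_lambda _ fun i => Int.measurable_floor.comp ?_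
  fun_prop

theorem integral_comp_dyadicIndex {R n : ℕ} (a : Measure (E m)) [IsFiniteMeasure a]
    (ha : ∀ᵐ x ∂a, ∀ i, |x i| ≤ (R : ℝ)) (g : (Fin m → ℤ) → ℝ) :
    ∫ x, g (dyadicIndex n x) ∂a
      = ∑ k ∈ dyadicBox m R n, a.real (dyadicIndex n ⁻¹' {k}) * g k := by
  have hmeas : ∀ k, MeasurableSet (dyadicIndex n ⁻¹' {k} : Set (E m)) := fun k =>
    measurable_dyadicIndex n (measurableSet_singleton k)
  have h : ∀ᵐ x ∂a, g (dyadicIndex n x) = ∑ k ∈ dyadicBox m R n,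
      (dyadicIndex n ⁻¹' {k}).indicator (fun _ => g k) x := by
    filter_upwards [ha] with x hx
    rw [Finset.sum_eq_single_of_mem _ (dyadicIndex_mem_dyadicBox hx)]
    · simp
    · intro k _ hk
      exact indicator_of_notMem (fun h => hk h.symm) _
  rw [integral_congr_ae h, integral_finsetSum]
  · refine Finset.sum_congr rfl fun k _ => ?_
    rw [integral_indicator_const _ (hmeas k), smul_eq_mul]
  · exact fun k _ => (integrable_const _).indicator (hmeas k)

/-- The costs of the dyadic levels decay like powers of `2^(m(1 - α) - 1) < 1`. -/
theorem summable_card_dyadicBox_rpow {α : ℝ} (hα : 1 - 1 / (m : ℝ) < α) (hα1 : α ≤ 1) {R : ℕ}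
    (hR : 1 ≤ R) :
    Summable fun n => ((dyadicBox m R n).card : ℝ) ^ (1 - α) * (√m * (R / 2 ^ n)) := by
  -- `m = 0` is excluded because `1 / 0 = 0` turns the hypotheses into `1 < α ≤ 1`.
  have hm : 0 < (m : ℝ) := by
    rcases Nat.eq_zero_or_pos m with rfl | h
    · simp only [Nat.cast_zero, div_zero, sub_zero] at hα; linarith
    · exact_mod_cast h
  have hexp : m * (1 - α) < 1 := by
    have : 1 - α < 1 / m := by linarith
    calc m * (1 - α) < m * (1 / m) := by gcongr
      _ = 1 := by field_simp
  set r : ℝ := 2 ^ (m * (1 - α)) / 2 with hr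
  have hr1 : r < 1 := by
    rw [hr, div_lt_one two_pos]
    calc (2 : ℝ) ^ (m * (1 - α)) < 2 ^ (1 : ℝ) := Real.rpow_lt_rpow_of_exponent_lt one_lt_two hexp
      _ = 2 := Real.rpow_one 2
  have hr0 : 0 ≤ r := by positivity
  refine Summable.of_nonneg_of_le (fun n => by positivity) (fun n => ?_)
    ((summable_geometric_of_lt_one hr0 hr1).mul_left ((3 * R : ℝ) ^ (m * (1 - α)) * (√m * R)))
  have h1 : ((dyadicBox m R n).card : ℝ) ≤ (3 * R * 2 ^ n) ^ m := by
    rw [card_dyadicBox]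
    have h : 2 * (R * 2 ^ n) + 1 ≤ 3 * R * 2 ^ n := by
      have : 1 ≤ R * 2 ^ n := Nat.one_le_iff_ne_zero.2 (by positivity)
      linarith
    exact_mod_cast Nat.pow_le_pow_left h m
  have h2 : ((dyadicBox m R n).card : ℝ) ^ (1 - α)
      ≤ (3 * R : ℝ) ^ (m * (1 - α)) * (2 ^ (m * (1 - α))) ^ n := by
    calc ((dyadicBox m R n).card : ℝ) ^ (1 - α) ≤ ((3 * R * 2 ^ n : ℝ) ^ m) ^ (1 - α) :=
          Real.rpow_le_rpow (by positivity) h1 (by linarith)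
      _ = (3 * R * 2 ^ n : ℝ) ^ (m * (1 - α)) := by
          rw [← Real.rpow_natCast, ← Real.rpow_mul (by positivity)]
      _ = _ := by
          rw [Real.mul_rpow (by positivity) (by positivity)]
          congr 1
          rw [← Real.rpow_natCast, ← Real.rpow_natCast, ← Real.rpow_mul two_pos.le,
            ← Real.rpow_mul two_pos.le, mul_comm]
  calc _ ≤ (3 * R : ℝ) ^ (m * (1 - α)) * (2 ^ (m * (1 - α))) ^ n * (√m * (R / 2 ^ n)) := by
        gcongr
    _ = _ := by
        rw [hr, div_pow]
        ring

/-- A bound for the `α`-mass of the dyadic transport of a unit mass on `[-R, R]ᵐ`; a total mass `ε`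
multiplies it by `ε^α`. -/
noncomputable def dyadicConst (m R : ℕ) (α : ℝ) : ℝ≥0∞ :=
  ∑' n, ENNReal.ofReal (((dyadicBox m R n).card : ℝ) ^ (1 - α) * (√m * (R / 2 ^ n)))

theorem dyadicConst_ne_top {α : ℝ} (hα : 1 - 1 / (m : ℝ) < α) (hα1 : α ≤ 1) {R : ℕ}
    (hR : 1 ≤ R) : dyadicConst m R α ≠ ⊤ :=
  (summable_card_dyadicBox_rpow hα hα1 hR).tsum_ofReal_ne_top

theorem tsum_dyadic_le {α : ℝ} (hα : 0 < α) (hα1 : α ≤ 1) {R : ℕ}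
    (hR : 1 ≤ R) (a : Measure (E m)) [IsFiniteMeasure a] :
    ∑' i : Σ n, dyadicBox m R n,
        ENNReal.ofReal (a.real (dyadicIndex i.1 ⁻¹' {i.2.1})) ^ α *
          ENNReal.ofReal ‖dyadicPoint i.1 i.2.1 - dyadicParent i.1 i.2.1‖
      ≤ dyadicConst m R α * a univ ^ α := by
  rw [ENNReal.tsum_sigma', dyadicConst, ← ENNReal.tsum_mul_right]
  refine ENNReal.tsum_le_tsum fun n => ?_
  rw [Finset.tsum_subtype (dyadicBox m R n) fun k =>
    ENNReal.ofReal (a.real (dyadicIndex n ⁻¹' {k})) ^ α *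
          ENNReal.ofReal ‖dyadicPoint n k - dyadicParent n k‖]
  have hw : ∀ k, ENNReal.ofReal (a.real (dyadicIndex n ⁻¹' {k})) = a (dyadicIndex n ⁻¹' {k}) :=
    fun k => ofReal_measureReal (measure_ne_top a _)
  simp_rw [hw]
  calc _ ≤ ∑ k ∈ dyadicBox m R n, a (dyadicIndex n ⁻¹' {k}) ^ α *
          ENNReal.ofReal (√m * (R / 2 ^ n)) := by
        gcongr with k hk
        exact norm_dyadicPoint_sub_dyadicParent_le hR hk
    _ = (∑ k ∈ dyadicBox m R n, a (dyadicIndex n ⁻¹' {k}) ^ α) *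
          ENNReal.ofReal (√m * (R / 2 ^ n)) := (Finset.sum_mul _ _ _).symm
    _ ≤ ((dyadicBox m R n).card : ℝ≥0∞) ^ (1 - α) * a univ ^ α *
          ENNReal.ofReal (√m * (R / 2 ^ n)) := by
        gcongr
        refine (sum_rpow_le_card_rpow_mul hα hα1 _ _).trans ?_
        gcongr
        rw [sum_measure_preimage_singleton _ fun k _ =>
          measurable_dyadicIndex n (measurableSet_singleton k)]
        exact measure_mono (subset_univ _)
    _ = _ := by
        rw [ENNReal.ofReal_mul (p := ((dyadicBox m R n).card : ℝ) ^ (1 - α)) (by positivity),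
          ← ENNReal.ofReal_rpow_of_nonneg
          (Nat.cast_nonneg _) (by linarith), ENNReal.ofReal_natCast]
        ring

/-- Xia's construction: the mass in each dyadic cube is sent to the corner of the parent cube. There
are about `2^(nm)` cubes at level `n`, so by concavity this level costs at most
`2^(nm(1 - α)) · 2⁻ⁿ` up to constants, which is summable exactly for `α > 1 - 1/m`. -/
theorem exists_field_to_origin {α : ℝ} (hα : 1 - 1 / (m : ℝ) < α) (hα0 : 0 < α) (hα1 : α ≤ 1)
    {R : ℕ} (hR : 1 ≤ R) (a : Measure (E m)) [IsFiniteMeasure a]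
    (ha : ∀ᵐ x ∂a, ∀ i, |x i| ≤ (R : ℝ)) :
    ∃ V : E m → E m, IsRectifiableField V ∧
      fieldCost α V ≤ dyadicConst m R α * a univ ^ α ∧
      ∀ φ : ZeroForm m,
        fieldCurrent V (extDeriv φ) = ∫ x, φ x ∂a - a.real univ * φ 0 := by
  -- Exponent `1` bounds the total length, so the series of segments converges.
  have hfin := (tsum_dyadic_le one_pos le_rfl hR a).trans_lt (ENNReal.mul_lt_top
    (dyadicConst_ne_top (m := m) (hα.trans_le hα1) le_rfl hR).lt_top (by simp))
  simp only [ENNReal.rpow_one] at hfin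
  obtain ⟨V, hV, hcost, hbd⟩ := exists_field_of_segments
    (fun i : Σ n, dyadicBox m R n => dyadicParent i.1 i.2.1)
    (fun i => dyadicPoint i.1 i.2.1) (fun i => a.real (dyadicIndex i.1 ⁻¹' {i.2.1}))
    (fun i => measureReal_nonneg) hfin.ne
  refine ⟨V, hV, (hcost α hα0 hα1).trans (tsum_dyadic_le hα0 hα1 hR a), fun φ => ?_⟩
  have hφc : Continuous φ := φ.contDiff.continuous
  obtain ⟨B, hB⟩ := φ.hasCompactSupport.exists_bound_of_continuous hφc
  -- `f n` is the rounding map whose image measures are the successive boundaries.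
  let f : ℕ → E m → E m := fun n x => dyadicParent n (dyadicIndex n x)
  have hf : ∀ n x, f (n + 1) x = dyadicPoint n (dyadicIndex n x) :=
    fun n x => dyadicParent_dyadicIndex_succ n x
  have hfint : ∀ n, Integrable (fun x => φ (f n x)) a := by
    intro n
    refine Integrable.of_bound (C := B) ?_ (ae_of_all _ fun x => hB _)
    exact (hφc.measurable.comp ((measurable_of_countable (dyadicParent n)).comp
      (measurable_dyadicIndex n))).aestronglyMeasurable
  have hlevel : ∀ n, ∑ k ∈ dyadicBox m R n, a.real (dyadicIndex n ⁻¹' {k}) *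
      (φ (dyadicPoint n k) - φ (dyadicParent n k))
        = (∫ x, φ (f (n + 1) x) ∂a) - ∫ x, φ (f n x) ∂a := by
    intro n
    rw [← integral_sub (hfint _) (hfint _), ← integral_comp_dyadicIndex a ha fun k =>
      φ (dyadicPoint n k) - φ (dyadicParent n k)]
    simp only [hf, f]
  have hsum := ((hbd φ).sigma fun n => (hasSum_fintype _)).tendsto_sum_nat
  have hpart : ∀ N, ∑ n ∈ Finset.range N, ∑ k : dyadicBox m R n,
      a.real (dyadicIndex n ⁻¹' {k.1}) * (φ (dyadicPoint n k.1) - φ (dyadicParent n k.1))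
        = (∫ x, φ (f N x) ∂a) - ∫ x, φ (f 0 x) ∂a := by
    intro N
    rw [← Finset.sum_range_sub fun n => ∫ x, φ (f n x) ∂a]
    refine Finset.sum_congr rfl fun n _ => ?_
    rw [← hlevel, Finset.sum_coe_sort (dyadicBox m R n) fun k =>
      a.real (dyadicIndex n ⁻¹' {k}) * (φ (dyadicPoint n k) - φ (dyadicParent n k))]
  simp only [hpart] at hsum
  have h0 : ∫ x, φ (f 0 x) ∂a = a.real univ * φ 0 := by
    simp [f, dyadicParent]
  have hlim : Tendsto (fun N => ∫ x, φ (f N x) ∂a) atTop (𝓝 (∫ x, φ x ∂a)) := by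
    refine tendsto_integral_of_dominated_convergence (fun _ => B) (fun n => (hfint n).1)
      (integrable_const B) (fun n => ae_of_all _ fun x => hB _) (ae_of_all _ fun x => ?_)
    refine (hφc.tendsto x).comp ((tendsto_add_atTop_iff_nat 1).1 ?_)
    simpa only [hf] using tendsto_dyadicPoint_dyadicIndex x
  rw [h0] at hsum
  exact tendsto_nhds_unique hsum (hlim.sub_const _)

/-! ### Signed measures as `0`-currents and their mass -/

theorem ZeroForm.integrable (φ : ZeroForm m) (a : Measure (E m)) [IsFiniteMeasure a] :
    Integrable φ a :=
  φ.contDiff.continuous.integrable_of_hasCompactSupport φ.hasCompactSupport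

theorem ofSigned_apply (σ : SignedMeasure (E m)) (φ : ZeroForm m) :
    ofSigned σ φ = ∫ x, φ x ∂σ.toJordanDecomposition.posPart -
      ∫ x, φ x ∂σ.toJordanDecomposition.negPart := by
  rw [ofSigned, sub_apply, ofMeasure_apply, ofMeasure_apply]

theorem mutuallySingular_of_disjoint_support {μ ν : Measure (E m)}
    (h : Disjoint μ.support ν.support) : ν ⟂ₘ μ := by
  refine ⟨ν.supportᶜ, Measure.isClosed_support.measurableSet.compl,
    Measure.measure_compl_support, ?_⟩
  rw [compl_compl]
  exact measure_mono_null h.subset_compl_left Measure.measure_compl_support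

theorem toJordanDecomposition_diffMeasure {μ ν : Measure (E m)} [IsFiniteMeasure μ]
    [IsFiniteMeasure ν] (h : ν ⟂ₘ μ) :
    (diffMeasure μ ν).toJordanDecomposition = { posPart := ν, negPart := μ, mutuallySingular := h } :=
  SignedMeasure.toJordanDecomposition_eq rfl

theorem mass_le_of_forall_eq {S : ZeroCurrent m} {a b : Measure (E m)} [IsFiniteMeasure a]
    [IsFiniteMeasure b] (h : ∀ φ : ZeroForm m, S φ = ∫ x, φ x ∂a - ∫ x, φ x ∂b) :
    mass S ≤ a univ + b univ := by
  refine iSup₂_le fun φ hφ => ?_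
  have hbound : ∀ c : Measure (E m), IsFiniteMeasure c → |∫ x, φ x ∂c| ≤ c.real univ := by
    intro c hc
    simpa using norm_integral_le_of_norm_le_const (μ := c) (f := φ) (C := 1) (ae_of_all _ hφ)
  rw [← ofReal_measureReal (measure_ne_top a univ), ← ofReal_measureReal (measure_ne_top b univ),
    ← ENNReal.ofReal_add measureReal_nonneg measureReal_nonneg, h]
  refine ENNReal.ofReal_le_ofReal ((abs_sub _ _).trans ?_)
  exact add_le_add (hbound a inferInstance) (hbound b inferInstance)

theorem exists_zeroForm_separating {K L : Set (E m)} (hK : IsCompact K) (hL : IsCompact L)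
    (hKL : Disjoint K L) :
    ∃ φ : ZeroForm m, (∀ x, |φ x| ≤ 1) ∧ (∀ x ∈ K, φ x = 1) ∧ ∀ x ∈ L, φ x = -1 := by
  obtain ⟨g, hg0, hg1, hg⟩ := exists_contMDiffMap_zero_one_of_isClosed (modelWithCornersSelf ℝ (E m))
    (n := ⊤) hL.isClosed hK.isClosed hKL.symm
  obtain ⟨r, hr0, hr⟩ := (hK.union hL).isBounded.subset_closedBall_lt 0 0
  let χ : ContDiffBump (0 : E m) := ⟨r, r + 1, hr0, lt_add_one r⟩
  have hχ : ∀ x ∈ K ∪ L, χ x = 1 := fun x hx => χ.one_of_mem_closedBall (hr hx)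
  refine ⟨⟨fun x => χ x * (2 * g x - 1), ?_, χ.hasCompactSupport.mul_right, fun _ _ => trivial⟩,
    fun x => ?_, fun x hx => ?_, fun x hx => ?_⟩
  · exact χ.contDiff.mul ((contDiff_const.mul g.contMDiff.contDiff).sub contDiff_const)
  · change |χ x * (2 * g x - 1)| ≤ 1
    rw [abs_mul]
    refine mul_le_one₀ ?_ (abs_nonneg _) ?_
    · rw [abs_of_nonneg χ.nonneg]; exact χ.le_one
    · obtain ⟨h0, h1⟩ := hg x
      rw [abs_le]; constructor <;> linarith
  · change χ x * (2 * g x - 1) = 1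
    rw [hχ x (Or.inl hx), hg1 hx]; norm_num
  · change χ x * (2 * g x - 1) = -1
    rw [hχ x (Or.inr hx), hg0 hx]; norm_num

/-- The lower bound for the mass of `ν - μ`, attained by a test function equal to `1` on the support
of `ν` and to `-1` on the support of `μ`. -/
theorem le_mass_ofSigned_diffMeasure {X : Set (E m)} (hX : IsCompact X) {μ ν : Measure (E m)}
    [IsFiniteMeasure μ] [IsFiniteMeasure ν] (hμX : μ Xᶜ = 0) (hνX : ν Xᶜ = 0)
    (hdisj : Disjoint μ.support ν.support) :
    ν univ + μ univ ≤ mass (ofSigned (diffMeasure μ ν)) := by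
  have hcompact : ∀ a : Measure (E m), a Xᶜ = 0 → IsCompact a.support := fun a ha =>
    hX.of_isClosed_subset Measure.isClosed_support (Measure.support_subset_of_isClosed hX.isClosed ha)
  obtain ⟨φ, hφ, hφν, hφμ⟩ :=
    exists_zeroForm_separating (hcompact ν hνX) (hcompact μ hμX) hdisj.symm
  refine le_trans ?_ (le_iSup₂ φ hφ)
  have h1 : ∫ x, φ x ∂ν = ν.real univ := by
    have h : ∀ᵐ x ∂ν, φ x = 1 := by
      filter_upwards [Measure.support_mem_ae (μ := ν)] with x hx using hφν x hx
    simp [integral_congr_ae h]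
  have h2 : ∫ x, φ x ∂μ = -μ.real univ := by
    have h : ∀ᵐ x ∂μ, φ x = -1 := by
      filter_upwards [Measure.support_mem_ae (μ := μ)] with x hx using hφμ x hx
    simp [integral_congr_ae h]
  rw [ofSigned_apply, toJordanDecomposition_diffMeasure (mutuallySingular_of_disjoint_support hdisj),
    h1, h2, sub_neg_eq_add, abs_of_nonneg (add_nonneg measureReal_nonneg measureReal_nonneg),
    ENNReal.ofReal_add measureReal_nonneg measureReal_nonneg,
    ofReal_measureReal, ofReal_measureReal]

/-- The boundary of a current of finite mass has total charge zero: test it with cutoff functions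
whose gradients tend uniformly to zero. -/
theorem measure_univ_eq_of_boundary {V : E m → E m}
    (hV : Integrable V (Measure.hausdorffMeasure 1)) {a b : Measure (E m)} [IsFiniteMeasure a]
    [IsFiniteMeasure b]
    (h : ∀ φ : ZeroForm m, fieldCurrent V (extDeriv φ) = ∫ x, φ x ∂a - ∫ x, φ x ∂b) :
    a univ = b univ := by
  let χ : ContDiffBump (0 : E m) := ⟨1, 2, one_pos, one_lt_two⟩
  have hχ : ContDiff ℝ ∞ χ := χ.contDiff
  obtain ⟨C, hC⟩ := (χ.hasCompactSupport.fderiv (𝕜 := ℝ)).exists_bound_of_continuous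
    (hχ.continuous_fderiv (by simp))
  have hn : ∀ n : ℕ, ((n : ℝ) + 1)⁻¹ ≠ 0 := fun n => by positivity
  let φ : ℕ → ZeroForm m := fun n =>
    ⟨fun x => χ (((n : ℝ) + 1)⁻¹ • x), hχ.comp (contDiff_const_smul _),
      χ.hasCompactSupport.comp_smul (hn n), fun _ _ => trivial⟩
  have hφ : ∀ n x, φ n x = χ (((n : ℝ) + 1)⁻¹ • x) := fun _ _ => rfl
  have hinv : Tendsto (fun n : ℕ => ((n : ℝ) + 1)⁻¹) atTop (𝓝 0) := by
    simpa only [one_div] using tendsto_one_div_add_atTop_nhds_zero_nat (𝕜 := ℝ)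
  have hone : χ 0 = 1 := χ.one_of_mem_closedBall (Metric.mem_closedBall_self zero_le_one)
  have hlim : ∀ c : Measure (E m), IsFiniteMeasure c →
      Tendsto (fun n => ∫ x, φ n x ∂c) atTop (𝓝 (c.real univ)) := by
    intro c hc
    have hc1 : c.real univ = ∫ _, (1 : ℝ) ∂c := by simp
    rw [hc1]
    refine tendsto_integral_of_dominated_convergence (fun _ => 1)
      (fun n => ((φ n).integrable c).1) (integrable_const 1)
      (fun n => ae_of_all _ fun x => ?_) (ae_of_all _ fun x => ?_)
    · rw [hφ, Real.norm_of_nonneg χ.nonneg]; exact χ.le_one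
    · rw [← hone]
      refine (χ.continuous.tendsto 0).comp ?_
      simpa using hinv.smul_const x
  have hzero : Tendsto (fun n => fieldCurrent V (extDeriv (φ n))) atTop (𝓝 0) := by
    have hb : Tendsto (fun n : ℕ => ((n : ℝ) + 1)⁻¹ *
        (C * ∫ x, ‖V x‖ ∂(Measure.hausdorffMeasure 1))) atTop (𝓝 0) := by
      simpa using hinv.mul_const (C * ∫ x, ‖V x‖ ∂(Measure.hausdorffMeasure 1 : Measure (E m)))
    refine squeeze_zero_norm (fun n => ?_) hb
    rw [fieldCurrent_apply hV, ← integral_const_mul, ← integral_const_mul]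
    refine norm_integral_le_of_norm_le ((hV.norm.const_mul C).const_mul _) (ae_of_all _ fun x => ?_)
    have hd : extDeriv (φ n) x = ((n : ℝ) + 1)⁻¹ • fderiv ℝ χ (((n : ℝ) + 1)⁻¹ • x) := by
      rw [extDeriv_apply]
      exact fderiv_comp_smul (𝕜 := ℝ) (f := χ) (c := ((n : ℝ) + 1)⁻¹)
    rw [hd, smul_apply, norm_smul, Real.norm_of_nonneg (by positivity)]
    gcongr
    exact (fderiv ℝ χ _).le_of_opNorm_le (hC _) _
  have hdiff := (hlim a inferInstance).sub (hlim b inferInstance)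
  simp only [h] at hzero
  have := tendsto_nhds_unique hdiff hzero
  exact (measureReal_eq_measureReal_iff).1 (sub_eq_zero.1 this)

/-! ### Cheap corrections of the boundary -/

/-- Two measures of equal mass on a bounded set are joined through the origin. -/
theorem exists_field_between {α : ℝ} (hα : 1 - 1 / (m : ℝ) < α) (hα0 : 0 < α) (hα1 : α ≤ 1)
    {R : ℕ} (hR : 1 ≤ R) (a b : Measure (E m)) [IsFiniteMeasure a] [IsFiniteMeasure b]
    (ha : ∀ᵐ x ∂a, ∀ i, |x i| ≤ (R : ℝ)) (hb : ∀ᵐ x ∂b, ∀ i, |x i| ≤ (R : ℝ))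
    (hab : a univ = b univ) :
    ∃ V : E m → E m, IsRectifiableField V ∧
      fieldCost α V ≤ 2 * dyadicConst m R α * a univ ^ α ∧
      ∀ φ : ZeroForm m, fieldCurrent V (extDeriv φ) = ∫ x, φ x ∂a - ∫ x, φ x ∂b := by
  obtain ⟨V, hV, hVcost, hVbd⟩ := exists_field_to_origin hα hα0 hα1 hR a ha
  obtain ⟨W, hW, hWcost, hWbd⟩ := exists_field_to_origin hα hα0 hα1 hR b hb
  obtain ⟨hadd, hcur, hcost⟩ := hV.add hW.neg
  refine ⟨fun x => V x + -W x, hadd, ?_, fun φ => ?_⟩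
  · refine (hcost α hα0 hα1).trans ?_
    rw [fieldCost_neg, mul_assoc, two_mul]
    exact add_le_add hVcost (hab ▸ hWcost)
  · rw [hcur, add_apply, fieldCurrent_neg hW.integrable, neg_apply, hVbd, hWbd,
      measureReal_def, measureReal_def, hab]
    ring

theorem mAlpha_add_fieldCurrent_le {α : ℝ} (hα0 : 0 < α) (hα1 : α ≤ 1) (T : OneCurrent m)
    {W : E m → E m} (hW : IsRectifiableField W) :
    MAlpha α (T + fieldCurrent W) ≤ MAlpha α T + fieldCost α W := by
  refine ENNReal.le_of_forall_pos_le_add fun ε hε hlt => ?_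
  have hT : MAlpha α T ≠ ⊤ := ne_top_of_le_ne_top hlt.ne le_self_add
  obtain ⟨V, hV, rfl, hcost⟩ := exists_field_of_mAlpha_lt hα0
    (ENNReal.lt_add_right hT (ENNReal.coe_ne_zero.2 hε.ne'))
  obtain ⟨hadd, hcur, hcost'⟩ := hV.add hW
  rw [← hcur]
  calc _ ≤ fieldCost α V + fieldCost α W := (hadd.mAlpha_le hα0).trans (hcost' α hα0 hα1)
    _ ≤ MAlpha α (fieldCurrent V) + ε + fieldCost α W := by gcongr
    _ = _ := add_right_comm _ _ _

theorem IsRectifiableCurrent.add_fieldCurrent {T : OneCurrent m} (hT : IsRectifiableCurrent T)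
    {W : E m → E m} (hW : IsRectifiableField W) : IsRectifiableCurrent (T + fieldCurrent W) := by
  obtain ⟨V, hV, rfl⟩ := hT.exists_field
  obtain ⟨hadd, hcur, -⟩ := hV.add hW
  exact hcur ▸ hadd.isRectifiableCurrent

/-! ### Competitors and their residual boundary -/

section Transport

variable {μ ν : Measure (E m)} [IsFiniteMeasure μ] [IsFiniteMeasure ν]

theorem fieldCurrent_zero : fieldCurrent (fun _ : E m => (0 : E m)) = 0 := by
  ext η
  rw [fieldCurrent_apply isRectifiableField_zero.integrable]
  simp

theorem zero_mem_feasible : (0 : OneCurrent m) ∈ Feasible μ ν := by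
  refine ⟨?_, 0, ?_, ?_⟩
  · exact fieldCurrent_zero (m := m) ▸ isRectifiableField_zero.isRectifiableCurrent
  · ext φ
    simp [boundary, ofSigned_apply, SignedMeasure.toJordanDecomposition_zero,
      JordanDecomposition.zero_posPart, JordanDecomposition.zero_negPart]
  · simp only [Preceq, SignedMeasure.toJordanDecomposition_zero,
      JordanDecomposition.zero_posPart, JordanDecomposition.zero_negPart]
    exact ⟨Measure.zero_le _, Measure.zero_le _⟩

theorem mAlpha_zero {α : ℝ} (hα : 0 < α) : MAlpha α (0 : OneCurrent m) = 0 := by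
  have h2 := isRectifiableField_zero.mAlpha_le (m := m) hα
  rw [fieldCurrent_zero] at h2
  simpa [fieldCost, hα] using h2

theorem mass_boundary_zero : mass (boundary (0 : OneCurrent m)) = 0 := by
  simp [mass, boundary]

theorem mem_feasible_of_mem_path {T : OneCurrent m} (hT : T ∈ Path μ ν) : T ∈ Feasible μ ν :=
  ⟨hT.1, _, hT.2, le_rfl, le_rfl⟩

/-- The part of `ν - μ` that the boundary of a competitor leaves out is `a - b` with `a ≤ ν`,
`b ≤ μ` and `a`, `b` of equal mass. -/
theorem exists_residual (hsing : ν ⟂ₘ μ) (hmass : μ univ = ν univ) {T : OneCurrent m}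
    (hT : T ∈ Feasible μ ν) :
    ∃ a b : Measure (E m), a ≤ ν ∧ b ≤ μ ∧ a univ = b univ ∧
      (∀ φ : ZeroForm m, ofSigned (diffMeasure μ ν) φ - boundary T φ
        = ∫ x, φ x ∂a - ∫ x, φ x ∂b) ∧
      mass (boundary T) + (a univ + b univ) ≤ ν univ + μ univ := by
  obtain ⟨hrect, σ, hσ, hpos, hneg⟩ := hT
  rw [toJordanDecomposition_diffMeasure hsing] at hpos hneg
  simp only at hpos hneg
  have hbd : ∀ φ : ZeroForm m, boundary T φ = ∫ x, φ x ∂σ.toJordanDecomposition.posPart -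
      ∫ x, φ x ∂σ.toJordanDecomposition.negPart := fun φ => by rw [hσ, ofSigned_apply]
  generalize σ.toJordanDecomposition = j at hpos hneg hbd
  have heq : j.posPart univ = j.negPart univ := by
    obtain ⟨V, hV, rfl⟩ := hrect.exists_field
    exact measure_univ_eq_of_boundary hV.integrable hbd
  have hν := Measure.sub_add_cancel_of_le hpos
  have hμ := Measure.sub_add_cancel_of_le hneg
  refine ⟨ν - j.posPart, μ - j.negPart, Measure.sub_le, Measure.sub_le, ?_, fun φ => ?_, ?_⟩
  · rw [Measure.sub_apply MeasurableSet.univ hpos, Measure.sub_apply MeasurableSet.univ hneg,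
      heq, hmass]
  · have h1 : ∫ x, φ x ∂ν = ∫ x, φ x ∂(ν - j.posPart) + ∫ x, φ x ∂j.posPart := by
      rw [← integral_add_measure (φ.integrable _) (φ.integrable _), hν]
    have h2 : ∫ x, φ x ∂μ = ∫ x, φ x ∂(μ - j.negPart) + ∫ x, φ x ∂j.negPart := by
      rw [← integral_add_measure (φ.integrable _) (φ.integrable _), hμ]
    rw [ofSigned_apply, toJordanDecomposition_diffMeasure hsing, hbd, h1, h2]
    ring
  · calc _ ≤ j.posPart univ + j.negPart univ + ((ν - j.posPart) univ + (μ - j.negPart) univ) := by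
          gcongr
          exact mass_le_of_forall_eq hbd
      _ = (ν - j.posPart + j.posPart) univ + (μ - j.negPart + j.negPart) univ := by
          rw [Measure.add_apply, Measure.add_apply]
          ring
      _ = _ := by rw [hν, hμ]

end Transport

/-! ### Consequences of minimality -/

/-- For finite `α`-mass and finite boundary mass the extended-real energy has its real value. -/
theorem energy_eq_coe {α c : ℝ} {T : OneCurrent m} (hM : MAlpha α T ≠ ⊤)
    (hm : mass (boundary T) ≠ ⊤) :
    energy α c T = (((MAlpha α T).toReal - c * (mass (boundary T)).toReal : ℝ) : EReal) := by
  rw [energy]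
  lift MAlpha α T to NNReal using hM with M
  lift mass (boundary T) to NNReal using hm with d
  rfl

section Solution

variable {μ ν : Measure (E m)} [IsFiniteMeasure μ] [IsFiniteMeasure ν] {α : ℝ}

theorem mass_boundary_le (hsing : ν ⟂ₘ μ) (hmass : μ univ = ν univ) {T : OneCurrent m}
    (hT : T ∈ Feasible μ ν) : mass (boundary T) ≤ ν univ + μ univ := by
  obtain ⟨a, b, -, -, -, -, h⟩ := exists_residual hsing hmass hT
  exact le_self_add.trans h

theorem mass_boundary_ne_top (hsing : ν ⟂ₘ μ) (hmass : μ univ = ν univ) {T : OneCurrent m}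
    (hT : T ∈ Feasible μ ν) : mass (boundary T) ≠ ⊤ :=
  ne_top_of_le_ne_top (by simp) (mass_boundary_le hsing hmass hT)

theorem IsSolution.mAlpha_ne_top (hsing : ν ⟂ₘ μ) (hmass : μ univ = ν univ) (hα : 0 < α)
    {c : ℝ} {T : OneCurrent m} (hT : IsSolution α c μ ν T) : MAlpha α T ≠ ⊤ := by
  intro htop
  have h := hT.2 0 zero_mem_feasible
  have hm := mass_boundary_ne_top hsing hmass hT.1
  rw [energy_eq_coe (T := 0) (by simp [mAlpha_zero hα]) (by simp [mass_boundary_zero]), energy, htop] at h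
  lift mass (boundary T) to NNReal using hm with d
  have h2 : ((⊤ : ℝ≥0∞) : EReal) - (c : EReal) * (((d : ℝ≥0∞)) : EReal) = ⊤ :=
    EReal.top_sub_coe (c * (d : ℝ))
  rw [h2] at h
  exact absurd h (not_le.2 (EReal.coe_lt_top _))

theorem IsSolution.le (hsing : ν ⟂ₘ μ) (hmass : μ univ = ν univ) (hα : 0 < α)
    {c : ℝ} {T S : OneCurrent m} (hT : IsSolution α c μ ν T) (hS : S ∈ Feasible μ ν)
    (hSM : MAlpha α S ≠ ⊤) :
    (MAlpha α T).toReal - c * (mass (boundary T)).toReal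
      ≤ (MAlpha α S).toReal - c * (mass (boundary S)).toReal := by
  have h := hT.2 S hS
  rw [energy_eq_coe (hT.mAlpha_ne_top hsing hmass hα) (mass_boundary_ne_top hsing hmass hT.1),
    energy_eq_coe hSM (mass_boundary_ne_top hsing hmass hS)] at h
  exact EReal.coe_le_coe_iff.1 h

theorem IsSolution.energy_le (hsing : ν ⟂ₘ μ) (hmass : μ univ = ν univ) (hα : 0 < α)
    {c c' : ℝ} (hc : c ≤ c') {T T' : OneCurrent m} (hT : IsSolution α c μ ν T)
    (hT' : IsSolution α c' μ ν T') : energy α c' T' ≤ energy α c T := by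
  have hM := hT.mAlpha_ne_top hsing hmass hα
  have hm := mass_boundary_ne_top hsing hmass hT.1
  refine (hT'.2 T hT.1).trans ?_
  rw [energy_eq_coe hM hm, energy_eq_coe hM hm, EReal.coe_le_coe_iff]
  gcongr

theorem IsSolution.mass_le (hsing : ν ⟂ₘ μ) (hmass : μ univ = ν univ) (hα : 0 < α)
    {c c' : ℝ} (hc : c < c') {T T' : OneCurrent m} (hT : IsSolution α c μ ν T)
    (hT' : IsSolution α c' μ ν T') : mass (boundary T) ≤ mass (boundary T') := by
  have h1 := hT.le hsing hmass hα hT'.1 (hT'.mAlpha_ne_top hsing hmass hα)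
  have h2 := hT'.le hsing hmass hα hT.1 (hT.mAlpha_ne_top hsing hmass hα)
  rw [← ENNReal.toReal_le_toReal (mass_boundary_ne_top hsing hmass hT.1)
    (mass_boundary_ne_top hsing hmass hT'.1)]
  nlinarith

theorem IsSolution.mAlpha_le (hsing : ν ⟂ₘ μ) (hmass : μ univ = ν univ) (hα : 0 < α)
    {c c' : ℝ} (hc : c < c') {T T' : OneCurrent m} (hT : IsSolution α c μ ν T)
    (hT' : IsSolution α c' μ ν T') : MAlpha α T ≤ MAlpha α T' := by
  have hM := hT.mAlpha_ne_top hsing hmass hα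
  have hM' := hT'.mAlpha_ne_top hsing hmass hα
  have hm' := mass_boundary_ne_top hsing hmass hT'.1
  rw [← ENNReal.toReal_le_toReal hM hM']
  rcases le_or_gt 0 c with hc0 | hc0
  · have h1 := hT.le hsing hmass hα hT'.1 hM'
    have h2 := (ENNReal.toReal_le_toReal (mass_boundary_ne_top hsing hmass hT.1) hm').2
      (hT.mass_le hsing hmass hα hc hT')
    nlinarith
  · -- For a negative payoff the zero current is a competitor, so `MAlpha α T = 0`.
    have h1 := hT.le hsing hmass hα zero_mem_feasible (by simp [mAlpha_zero hα])
    rw [mAlpha_zero hα, mass_boundary_zero] at h1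
    have h3 : 0 ≤ (mass (boundary T)).toReal := ENNReal.toReal_nonneg
    have h4 : 0 ≤ (MAlpha α T').toReal := ENNReal.toReal_nonneg
    simp only [ENNReal.toReal_zero, mul_zero, sub_zero] at h1
    nlinarith

/-- Comparison with transport paths: what is left of the boundary is paid for by `d_α`. -/
theorem IsSolution.le_dAlpha (hsing : ν ⟂ₘ μ) (hmass : μ univ = ν univ) (hα : 0 < α)
    {c : ℝ} {T : OneCurrent m} (hT : IsSolution α c μ ν T) :
    ENNReal.ofReal ((MAlpha α T).toReal + c * ((mass (ofSigned (diffMeasure μ ν))).toReal -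
      (mass (boundary T)).toReal)) ≤ dAlpha α μ ν := by
  refine le_iInf₂ fun S hS => ?_
  rcases eq_or_ne (MAlpha α S) ⊤ with h | h
  · simp [h]
  have h1 := hT.le hsing hmass hα (mem_feasible_of_mem_path hS) h
  rw [hS.2] at h1
  rw [← ENNReal.ofReal_toReal h]
  exact ENNReal.ofReal_le_ofReal (by linarith)

end Solution

/-! ### The limit of large payoffs -/

section Limit

variable {X : Set (E m)} {μ ν : Measure (E m)} [IsFiniteMeasure μ] [IsFiniteMeasure ν] {α : ℝ}

theorem exists_nat_coord_bound (hX : IsCompact X) :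
    ∃ R : ℕ, 1 ≤ R ∧ ∀ a : Measure (E m), a Xᶜ = 0 → ∀ᵐ x ∂a, ∀ i, |x i| ≤ (R : ℝ) := by
  obtain ⟨r, hr⟩ := hX.isBounded.exists_norm_le
  refine ⟨⌈r⌉₊ + 1, Nat.le_add_left 1 _, fun a ha => ?_⟩
  filter_upwards [measure_eq_zero_iff_ae_notMem.1 ha] with x hx i
  have h1 : |x i| ≤ ‖x‖ := PiLp.norm_apply_le x i
  have h2 := hr x (not_notMem.1 hx)
  have h3 := Nat.le_ceil r
  push_cast
  linarith

/-- The dyadic transport from `μ` to `ν` is a path of finite cost. -/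
theorem dAlpha_lt_top (hX : IsCompact X) (hμX : μ Xᶜ = 0) (hνX : ν Xᶜ = 0) (hsing : ν ⟂ₘ μ)
    (hmass : μ univ = ν univ) (hα : 1 - 1 / (m : ℝ) < α) (hα0 : 0 < α) (hα1 : α ≤ 1) :
    dAlpha α μ ν < ⊤ := by
  obtain ⟨R, hR, hbound⟩ := exists_nat_coord_bound hX
  obtain ⟨V, hV, hcost, hbd⟩ := exists_field_between hα hα0 hα1 hR ν μ (hbound ν hνX)
    (hbound μ hμX) hmass.symm
  have hpath : fieldCurrent V ∈ Path μ ν := by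
    refine ⟨hV.isRectifiableCurrent, ?_⟩
    ext φ
    rw [ofSigned_apply, toJordanDecomposition_diffMeasure hsing]
    exact hbd φ
  refine (iInf₂_le _ hpath).trans_lt (((hV.mAlpha_le hα0).trans hcost).trans_lt ?_)
  exact ENNReal.mul_lt_top (ENNReal.mul_lt_top (by simp) (dyadicConst_ne_top hα hα1 hR).lt_top)
    (ENNReal.rpow_lt_top_of_nonneg hα0.le (measure_ne_top _ _))

/-- Completing a solution to a transport path by a cheap transport of its residual boundary. -/
theorem IsSolution.exists_residual_bounds (hX : IsCompact X) (hμX : μ Xᶜ = 0) (hνX : ν Xᶜ = 0)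
    (hdisj : Disjoint μ.support ν.support) (hmass : μ univ = ν univ)
    (hα : 1 - 1 / (m : ℝ) < α) (hα0 : 0 < α) (hα1 : α ≤ 1) {R : ℕ} (hR : 1 ≤ R)
    (hbound : ∀ a : Measure (E m), a Xᶜ = 0 → ∀ᵐ x ∂a, ∀ i, |x i| ≤ (R : ℝ))
    {c : ℝ} (hc : 0 < c) {T : OneCurrent m} (hT : IsSolution α c μ ν T) :
    MAlpha α T ≤ dAlpha α μ ν ∧
      mass (boundary T - ofSigned (diffMeasure μ ν)) ≤
        ENNReal.ofReal ((dAlpha α μ ν).toReal / c) ∧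
      dAlpha α μ ν ≤ MAlpha α T + 2 * dyadicConst m R α *
        ENNReal.ofReal ((dAlpha α μ ν).toReal / c) ^ α := by
  have hsing := mutuallySingular_of_disjoint_support hdisj
  have hM := hT.mAlpha_ne_top hsing hmass hα0
  have hm := mass_boundary_ne_top hsing hmass hT.1
  have hd := (dAlpha_lt_top hX hμX hνX hsing hmass hα hα0 hα1).ne
  obtain ⟨a, b, haν, hbμ, hab, hres, hle⟩ := exists_residual hsing hmass hT.1
  have : IsFiniteMeasure a := isFiniteMeasure_of_le ν haν
  have : IsFiniteMeasure b := isFiniteMeasure_of_le μ hbμ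
  have hmass_eq : mass (ofSigned (diffMeasure μ ν)) = ν univ + μ univ := by
    refine le_antisymm (mass_le_of_forall_eq fun φ => ?_)
      (le_mass_ofSigned_diffMeasure hX hμX hνX hdisj)
    rw [ofSigned_apply, toJordanDecomposition_diffMeasure hsing]
  have hkey := hT.le_dAlpha hsing hmass hα0
  rw [ENNReal.ofReal_le_iff_le_toReal hd, hmass_eq] at hkey
  have habs : a.real univ + b.real univ ≤ (ν univ + μ univ).toReal -
      (mass (boundary T)).toReal := by
    have h := ENNReal.toReal_mono (by simp) hle
    rw [ENNReal.toReal_add hm (by simp), ENNReal.toReal_add (measure_ne_top _ _)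
      (measure_ne_top _ _)] at h
    simp only [measureReal_def]
    linarith
  have ha0 : 0 ≤ a.real univ := measureReal_nonneg
  have hb0 : 0 ≤ b.real univ := measureReal_nonneg
  have hM0 : 0 ≤ (MAlpha α T).toReal := ENNReal.toReal_nonneg
  have hcab : c * (a.real univ + b.real univ) ≤ (dAlpha α μ ν).toReal - (MAlpha α T).toReal := by
    nlinarith
  have hcab0 : 0 ≤ c * (a.real univ + b.real univ) := by positivity
  have hab_le : a.real univ + b.real univ ≤ (dAlpha α μ ν).toReal / c := by
    rw [le_div_iff₀ hc]; linarith
  have hab_le' : a univ + b univ ≤ ENNReal.ofReal ((dAlpha α μ ν).toReal / c) := by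
    rw [← ofReal_measureReal (measure_ne_top a univ), ← ofReal_measureReal (measure_ne_top b univ),
      ← ENNReal.ofReal_add ha0 hb0]
    exact ENNReal.ofReal_le_ofReal hab_le
  refine ⟨?_, ?_, ?_⟩
  · rw [← ENNReal.toReal_le_toReal hM hd]
    linarith
  · refine le_trans (mass_le_of_forall_eq (a := b) (b := a) fun φ => ?_)
      ((add_comm _ _).trans_le hab_le')
    rw [sub_apply, ← neg_sub, hres, neg_sub]
  · obtain ⟨W, hW, hWcost, hWbd⟩ := exists_field_between hα hα0 hα1 hR a b
      (hbound a (haν.absolutelyContinuous hνX)) (hbound b (hbμ.absolutelyContinuous hμX)) hab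
    have hpath : T + fieldCurrent W ∈ Path μ ν := by
      refine ⟨hT.1.1.add_fieldCurrent hW, ?_⟩
      ext φ
      have h1 : boundary (T + fieldCurrent W) φ
        = boundary T φ + fieldCurrent W (extDeriv φ) := rfl
      rw [h1, hWbd, ← hres, add_sub_cancel]
    refine (iInf₂_le _ hpath).trans ((mAlpha_add_fieldCurrent_le hα0 hα1 T hW).trans ?_)
    gcongr
    refine hWcost.trans ?_
    gcongr
    exact le_self_add.trans hab_le'

end Limit

end Ramified

theorem mainTheorem6 (m : ℕ) (X : Set (EuclideanSpace ℝ (Fin m)))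
    (hXconv : Convex ℝ X) (hXcomp : IsCompact X)
    (μ ν : MeasureTheory.Measure (EuclideanSpace ℝ (Fin m)))
    [MeasureTheory.IsFiniteMeasure μ] [MeasureTheory.IsFiniteMeasure ν]
    (hμX : μ Xᶜ = 0) (hνX : ν Xᶜ = 0)
    (hdisj : Disjoint μ.support ν.support)
    (hmass : μ Set.univ = ν Set.univ)
    (α : ℝ) (hα : 1 - 1 / (m : ℝ) < α) (hα1 : α < 1)
    (I : Set ℝ) (hI : Set.Ioi 0 ⊆ I)
    (T : ℝ → Ramified.OneCurrent m)
    (hT : ∀ c ∈ I, Ramified.IsSolution α c μ ν (T c)) :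
    AntitoneOn (fun c => Ramified.energy α c (T c)) I ∧
    (MonotoneOn (fun c => Ramified.MAlpha α (T c)) I ∧
      Ramified.dAlpha α μ ν < ⊤ ∧
      Filter.Tendsto (fun c => Ramified.MAlpha α (T c)) Filter.atTop
        (nhds (Ramified.dAlpha α μ ν))) ∧
    (MonotoneOn (fun c => Ramified.mass (Ramified.boundary (T c))) I ∧
      Filter.Tendsto
        (fun c => Ramified.mass
          (Ramified.boundary (T c) - Ramified.ofSigned (Ramified.diffMeasure μ ν)))
        Filter.atTop (nhds 0)) := by
  open Ramified in
  have hsing := mutuallySingular_of_disjoint_support hdisj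
  have hα0 : 0 < α := by
    refine lt_of_le_of_lt ?_ hα
    rcases Nat.eq_zero_or_pos m with rfl | hm
    · simp
    · rw [sub_nonneg, div_le_one (by exact_mod_cast hm)]
      exact_mod_cast hm
  have hd := dAlpha_lt_top hXcomp hμX hνX hsing hmass hα hα0 hα1.le
  obtain ⟨R, hR, hbound⟩ := exists_nat_coord_bound hXcomp
  have hbounds : ∀ᶠ c in atTop, _ := (eventually_gt_atTop (0 : ℝ)).mono fun c hc =>
    (hT c (hI hc)).exists_residual_bounds hXcomp hμX hνX hdisj hmass hα hα0 hα1.le hR hbound hc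
  have hdiv : Tendsto (fun c : ℝ => ENNReal.ofReal ((dAlpha α μ ν).toReal / c)) atTop (𝓝 0) := by
    simpa using ENNReal.tendsto_ofReal (tendsto_const_nhds.div_atTop tendsto_id)
  refine ⟨fun c hc c' hc' hcc' => (hT c hc).energy_le hsing hmass hα0 hcc' (hT c' hc'),
    ⟨fun c hc c' hc' hcc' => ?_, hd, ?_⟩, fun c hc c' hc' hcc' => ?_, ?_⟩
  · rcases hcc'.eq_or_lt with rfl | hlt
    · exact le_rfl
    · exact (hT c hc).mAlpha_le hsing hmass hα0 hlt (hT c' hc')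
  · have herr : Tendsto (fun c : ℝ => dAlpha α μ ν - 2 * dyadicConst m R α *
        ENNReal.ofReal ((dAlpha α μ ν).toReal / c) ^ α) atTop (𝓝 (dAlpha α μ ν)) := by
      have h1 := (ENNReal.continuous_rpow_const (y := α)).tendsto 0 |>.comp hdiv
      rw [ENNReal.zero_rpow_of_pos hα0] at h1
      have h2 := ENNReal.Tendsto.const_mul (a := 2 * dyadicConst m R α) h1
        (Or.inr (ENNReal.mul_ne_top (by simp) (dyadicConst_ne_top hα hα1.le hR)))
      rw [mul_zero] at h2
      simpa using ENNReal.Tendsto.sub (tendsto_const_nhds (x := dAlpha α μ ν)) h2 (Or.inl hd.ne)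
    refine tendsto_of_tendsto_of_tendsto_of_le_of_le' herr tendsto_const_nhds ?_ ?_
    · filter_upwards [hbounds] with c hc using tsub_le_iff_right.2 hc.2.2
    · filter_upwards [hbounds] with c hc using hc.1
  · rcases hcc'.eq_or_lt with rfl | hlt
    · exact le_rfl
    · exact (hT c hc).mass_le hsing hmass hα0 hlt (hT c' hc')
  · exact tendsto_of_tendsto_of_tendsto_of_le_of_le' tendsto_const_nhds hdiv
      (Eventually.of_forall fun c => zero_le) (hbounds.mono fun c hc => hc.2.1)
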